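/- Let $K$ be an arbitrary field. If $L/L_0$ is a finite separable extension of fields containing $K$, we say that $L/L_0$ is defined over an intermediate field $K\subset E_0\subset L_0$ if there is a field $E$ with $E_0\subset E\subset L$, $[E:E_0]=[L:L_0]$ and $L=EL_0$; the essential dimension $\mathrm{ed}_K(L/L_0)$ is the minimum of $\mathrm{trdeg}_K E_0$ over all such $E_0$. For a finite group $G$ put $\mathrm{ed}_K(G)=\mathrm{ed}_K(K(V)/K(V)^G)$, where $G\to GL(V)$ is any faithful finite-dimensional representation of $G$ over $K$ and $K(V)$ is the function field of the affine space $V$ (the value does not depend on the choice of the faithful representation). Let $n\ge 1$, let $D_n$ be the dihedral group of order $2n$, and let $\zeta_n$ denote a primitive $n$-th root of unity in an algebraic closure of $K$ when $\operatorname{char}K\nmid n$ (which includes the case $\operatorname{char}K=0$). **Theorem 5.8.** (1) Suppose $\operatorname{char}K\neq 2$. Then $\mathrm{ed}_K(D_n)=1$ if and only if both of the following conditions hold: (i) $n$ is odd; and (ii) if $\operatorname{char}K\nmid n$, then $\zeta_n+\zeta_n^{-1}\in K$; and if $\operatorname{char}K=p>0$ with $p\mid n$, then $n=p$. (2) Suppose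 $\operatorname{char}K=2$. Then $\mathrm{ed}_K(D_n)=1$ if and only if: in case $n$ is odd, $\zeta_n+\zeta_n^{-1}\in K$; in case $n$ is even, $n=2$ and $|K|\ge 4$. -/

import Mathlib

noncomputable section

namespace EssDim

section Extensions

variable {K L : Type*} [Field K] [Field L] [Algebra K L]

/-- For a finite extension `L / L₀` of fields containing `K`, and an intermediate field
`K ⊆ E₀ ⊆ L₀`: the extension `L / L₀` is defined over `E₀` if there is a field `E` with
`E₀ ⊆ E ⊆ L`, `[E : E₀] = [L : L₀]` and `L = E L₀`. -/
def IsDefinedOver (L₀ E₀ : IntermediateField K L) : Prop :=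
  E₀ ≤ L₀ ∧ ∃ (E : IntermediateField K L) (h : E₀ ≤ E),
    Module.finrank E₀ (IntermediateField.extendScalars h) = Module.finrank L₀ L ∧
    E ⊔ L₀ = ⊤

/-- The essential dimension `ed_K(L / L₀)` of a finite separable extension `L / L₀` of fields
containing `K`: the minimum of the transcendence degrees over `K` of the fields over which `L / L₀`
is defined. The infimum is over a nonempty set of cardinals, see `trdeg_mem`, hence attained. -/
def extEssDim (L₀ : IntermediateField K L) : Cardinal :=
  sInf {d : Cardinal | ∃ E₀ : IntermediateField K L, IsDefinedOver L₀ E₀ ∧ d = Algebra.trdeg K E₀}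

theorem isDefinedOver_self (L₀ : IntermediateField K L) : IsDefinedOver L₀ L₀ :=
  ⟨le_rfl, ⊤, le_top, by
    have h : IntermediateField.extendScalars (le_top : L₀ ≤ ⊤) = ⊤ := by
      ext x; simp
    rw [h]
    exact IntermediateField.finrank_top', by simp⟩

theorem trdeg_mem (L₀ : IntermediateField K L) :
    Algebra.trdeg K L₀ ∈
      {d : Cardinal | ∃ E₀ : IntermediateField K L,
        IsDefinedOver L₀ E₀ ∧ d = Algebra.trdeg K E₀} :=
  ⟨L₀, isDefinedOver_self L₀, rfl⟩

end Extensions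

section FunctionFields

variable (K V : Type*) [Field K] [AddCommGroup V] [Module K V]

/-- The coordinate ring of the affine space `V`: the symmetric algebra of the dual space, i.e. the
polynomial ring `K[x₁, …, xₘ]` on a basis `x₁, …, xₘ` of the dual space. -/
abbrev CoordRing : Type _ := SymmetricAlgebra K (Module.Dual K V)

/-- The function field `K(V) = K(x₁, …, xₘ)` of the affine space `V`. -/
abbrev FunField : Type _ := FractionRing (CoordRing K V)

variable {K V} {G : Type*} [Group G]

/-- The action of `g : G` on the coordinate ring of a representation: the `K`-algebra
homomorphism that extends the action of `g` on the dual space. -/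
def coordHom (ρ : Representation K G V) (g : G) : CoordRing K V →ₐ[K] CoordRing K V :=
  SymmetricAlgebra.lift (SymmetricAlgebra.ι K (Module.Dual K V) ∘ₗ ρ.dual g)

theorem coordHom_ι (ρ : Representation K G V) (g : G) (f : Module.Dual K V) :
    coordHom ρ g (SymmetricAlgebra.ι K _ f) = SymmetricAlgebra.ι K _ (ρ.dual g f) := by
  simp only [coordHom, SymmetricAlgebra.lift_ι_apply, LinearMap.comp_apply]

theorem coordHom_one (ρ : Representation K G V) : coordHom ρ 1 = AlgHom.id K _ := by
  apply SymmetricAlgebra.algHom_ext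
  refine LinearMap.ext fun f => ?_
  change coordHom ρ 1 (SymmetricAlgebra.ι K _ f) = SymmetricAlgebra.ι K _ f
  rw [coordHom_ι, map_one, Module.End.one_apply]

theorem coordHom_mul (ρ : Representation K G V) (g h : G) :
    coordHom ρ (g * h) = (coordHom ρ g).comp (coordHom ρ h) := by
  apply SymmetricAlgebra.algHom_ext
  refine LinearMap.ext fun f => ?_
  change coordHom ρ (g * h) (SymmetricAlgebra.ι K _ f) =
    coordHom ρ g (coordHom ρ h (SymmetricAlgebra.ι K _ f))
  rw [coordHom_ι, coordHom_ι, coordHom_ι, map_mul, Module.End.mul_apply]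

/-- The action of `G` on the coordinate ring of a representation by `K`-algebra automorphisms. -/
def coordAction (ρ : Representation K G V) : G →* (CoordRing K V ≃ₐ[K] CoordRing K V) where
  toFun g := AlgEquiv.ofAlgHom (coordHom ρ g) (coordHom ρ g⁻¹)
    (by rw [← coordHom_mul, mul_inv_cancel, coordHom_one])
    (by rw [← coordHom_mul, inv_mul_cancel, coordHom_one])
  map_one' := by
    ext x
    exact DFunLike.congr_fun (coordHom_one ρ) x
  map_mul' g h := by
    ext x
    exact DFunLike.congr_fun (coordHom_mul ρ g h) x

/-- The action of `G` on the function field `K(V)` of a representation by `K`-automorphisms. -/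
def funAction (ρ : Representation K G V) : G →* (FunField K V ≃ₐ[K] FunField K V) :=
  (IsFractionRing.fieldEquivOfAlgEquivHom K (FunField K V)).comp (coordAction ρ)

/-- The fixed field `K(V)^G`. -/
def invField (ρ : Representation K G V) : IntermediateField K (FunField K V) :=
  IntermediateField.fixedField (funAction ρ).range

/-- The essential dimension `ed_K(K(V) / K(V)^G)` attached to a representation `G → GL(V)`. For a
finite group `G` and any faithful finite-dimensional representation, this is the essential
dimension `ed_K(G)` of `G` over `K`. -/
def essDim (ρ : Representation K G V) : Cardinal :=
  extEssDim (invField ρ)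

end FunctionFields

/-- `ζₙ + ζₙ⁻¹ ∈ K`, where `ζₙ` is a primitive `n`-th root of unity in an algebraic closure
of `K`. (For `char K ∤ n` such roots exist, and the condition does not depend on the choice.) -/
def ZetaAddInvMem (K : Type*) [Field K] (n : ℕ) : Prop :=
  ∃ ζ : AlgebraicClosure K, IsPrimitiveRoot ζ n ∧
    ζ + ζ⁻¹ ∈ (algebraMap K (AlgebraicClosure K)).range

end EssDim

end

/-! A nontrivial finite group `G` has essential dimension one over `K` exactly when some
homomorphism `G → GL₂(K)` stays injective in `PGL₂(K)` (`essDim_eq_one_iff`). The theorem is this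
criterion evaluated on dihedral groups.

Write `L = K(V)`. Passing to the algebraic closure of `E₀` in `L`, respectively to invariants,
translates essential dimension one into the existence of a `G`-stable subfield `E` of `L` of
transcendence degree one on which `G` acts faithfully (`extEssDim_fixedField_eq_one_iff`).
Restriction to a suitable monomial curve embeds `E` into `K(t)`, so `E = K(s)` by Lüroth, and `G`
acts on `s` by Möbius transformations. This action lifts from `PGL₂` to `GL₂`: if `s = a / b` in
lowest terms in the coordinate ring, a factorial ring with units `Kˣ`, then `G` preserves the span
of `a` and `b`. Conversely, the normal basis theorem places a copy of the given plane inside `L`,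
and the quotient of two basis vectors generates the required field.

For `Dₙ`, commuting involutions exclude even `n` outside characteristic 2; the trace of the rotation
is `ζ + ζ⁻¹` when `char K ∤ n`; and when `p = char K` divides `n`, everything commuting with a
rotation of order `p` has exponent `p` modulo scalars. Explicit matrices give the converse. -/

/-- `G` has a two-dimensional representation over `K` in which only the identity acts by a scalar. -/
def HasProjFaithfulRep (K G : Type*) [Field K] [Group G] : Prop :=
  ∃ ψ : G →* Matrix (Fin 2) (Fin 2) K, ∀ (g : G) (c : K), ψ g = c • 1 → g = 1

/-! ### Two-by-two matrices -/

section TwoByTwo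

variable {K : Type*} [Field K]

theorem Matrix.mul_self_fin_two (M : Matrix (Fin 2) (Fin 2) K) :
    M * M = M.trace • M - M.det • 1 := by
  ext i j
  fin_cases i <;> fin_cases j <;>
    simp [Matrix.mul_apply, Matrix.trace_fin_two, Matrix.det_fin_two, Fin.sum_univ_two] <;> ring

/-- Cayley–Hamilton makes `tr M • M` scalar, so a nonscalar involution has trace zero. -/
theorem Matrix.det_eq_neg_one_of_mul_self {M : Matrix (Fin 2) (Fin 2) K} (h : M * M = 1)
    (hM : ∀ c : K, M ≠ c • 1) : M.det = -1 := by
  have h1 := M.mul_self_fin_two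
  rw [h] at h1
  have h2 : M.trace • M = (1 + M.det) • (1 : Matrix (Fin 2) (Fin 2) K) := by
    rw [add_smul, one_smul]
    exact (sub_eq_iff_eq_add.mp h1.symm)
  have h3 : M.trace = 0 := by
    by_contra ht
    refine hM (M.trace⁻¹ * (1 + M.det)) ?_
    rw [mul_smul, ← h2, smul_smul, inv_mul_cancel₀ ht, one_smul]
  have h4 := congrFun (congrFun h2 0) 0
  simp [h3] at h4
  linear_combination -h4

theorem one_add_nilpotent_pow {R : Type*} [Ring R] {N : R} (hN : N * N = 0) (m : ℕ) :
    (1 + N) ^ m = 1 + m • N := by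
  induction m with
  | zero => simp
  | succ m ih =>
    rw [pow_succ, ih, add_mul, mul_add, mul_add, smul_mul_assoc, smul_mul_assoc, hN, succ_nsmul]
    simp only [mul_one, one_mul, smul_zero, add_zero]
    abel

/-- The commutant of a nonscalar `2 × 2` matrix `N` consists of the matrices `α + β N`. -/
theorem Matrix.exists_eq_smul_one_add_smul {M N : Matrix (Fin 2) (Fin 2) K}
    (hN : ∀ c : K, N ≠ c • 1) (h : M * N = N * M) : ∃ α β : K, M = α • 1 + β • N := by
  have e00 := congrFun (congrFun h 0) 0
  have e01 := congrFun (congrFun h 0) 1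
  have e10 := congrFun (congrFun h 1) 0
  simp only [Matrix.mul_apply, Fin.sum_univ_two] at e00 e01 e10
  have key : ∀ α β : K, M 0 0 = α + β * N 0 0 → M 0 1 = β * N 0 1 → M 1 0 = β * N 1 0 →
      M 1 1 = α + β * N 1 1 → ∃ α β : K, M = α • 1 + β • N := by
    intro α β h1 h2 h3 h4
    refine ⟨α, β, ?_⟩
    ext i j
    fin_cases i <;> fin_cases j <;> simp [h1, h2, h3, h4]
  by_cases hb : N 0 1 = 0
  -- `β` is read off from whichever of `N 0 1`, `N 1 0`, `N 0 0 - N 1 1` is nonzero; all three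
  -- vanish only for scalar `N`.
  · by_cases hc : N 1 0 = 0
    · by_cases hd : N 0 0 = N 1 1
      · refine absurd ?_ (hN (N 0 0))
        ext i j
        fin_cases i <;> fin_cases j <;> simp [hb, hc, hd]
      · have hd' := sub_ne_zero.mpr hd
        refine key (M 0 0 - (M 0 0 - M 1 1) / (N 0 0 - N 1 1) * N 0 0)
          ((M 0 0 - M 1 1) / (N 0 0 - N 1 1)) (by ring) ?_ ?_ ?_
        · rw [hb] at e01 ⊢
          have : M 0 1 * (N 0 0 - N 1 1) = 0 := by linear_combination -e01
          simpa [hd'] using this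
        · rw [hc] at e10 ⊢
          have : M 1 0 * (N 0 0 - N 1 1) = 0 := by linear_combination e10
          simpa [hd'] using this
        · field_simp
          ring
    · refine key (M 0 0 - M 1 0 / N 1 0 * N 0 0) (M 1 0 / N 1 0) (by ring) ?_ (by field_simp) ?_
      · field_simp
        linear_combination e00
      · field_simp
        linear_combination e10
  · refine key (M 0 0 - M 0 1 / N 0 1 * N 0 0) (M 0 1 / N 0 1) (by ring) (by field_simp) ?_ ?_
    · field_simp
      linear_combination -e00
    · field_simp
      linear_combination -e01

/-- By Frobenius `u - 1` is nilpotent, and a nilpotent matrix of size two has square zero. -/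
theorem Matrix.sub_one_mul_self_of_pow_char {p : ℕ} [hp : Fact p.Prime] [CharP K p]
    {u : Matrix (Fin 2) (Fin 2) K} (hu : u ^ p = 1) : (u - 1) * (u - 1) = 0 := by
  have hN : (u - 1) ^ p = 0 := by
    rw [sub_pow_char_of_commute _ (Commute.one_right u), hu, one_pow, sub_self]
  set N := u - 1
  have hdet : N.det = 0 := by
    have := congrArg Matrix.det hN
    rw [Matrix.det_pow, Matrix.det_zero] at this
    exact pow_eq_zero_iff hp.out.ne_zero |>.mp this
  have hsq : N * N = N.trace • N := by rw [Matrix.mul_self_fin_two, hdet]; simp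
  have hpow : ∀ k : ℕ, N ^ (k + 1) = N.trace ^ k • N := by
    intro k
    induction k with
    | zero => simp
    | succ k ih => rw [pow_succ, ih, smul_mul_assoc, hsq, smul_smul, pow_succ]
  obtain ⟨k, hk⟩ := Nat.exists_eq_succ_of_ne_zero hp.out.ne_zero
  rw [hk, Nat.succ_eq_add_one, hpow] at hN
  rcases smul_eq_zero.mp hN with h | h
  · rw [hsq, eq_zero_of_pow_eq_zero h, zero_smul]
  · rw [h, mul_zero]

end TwoByTwo

/-! ### Dihedral groups: necessary conditions -/

section DihedralNecessity

open DihedralGroup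

variable {K : Type*} [Field K] {n : ℕ}

/-- For `n = 2m` the involutions `r m`, `sr 0` and their product would all have determinant `-1`,
which is impossible unless `2 = 0`. -/
theorem odd_of_hasProjFaithfulRep_dihedral (hn : 1 ≤ n) (h2 : ringChar K ≠ 2)
    (h : HasProjFaithfulRep K (DihedralGroup n)) : Odd n := by
  obtain ⟨ψ, hψ⟩ := h
  by_contra hodd
  obtain ⟨m, rfl⟩ := (Nat.not_odd_iff_even.mp hodd)
  have hm : ((m : ℕ) : ZMod (m + m)) ≠ 0 := by
    rw [Ne, ZMod.natCast_eq_zero_iff]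
    intro hd
    have := Nat.le_of_dvd (by omega) hd
    omega
  have hmm : ((m : ℕ) : ZMod (m + m)) + (m : ℕ) = 0 := by
    rw [← Nat.cast_add, ZMod.natCast_self]
  have key : ∀ g : DihedralGroup (m + m), g * g = 1 → g ≠ 1 → (ψ g).det = -1 := by
    intro g hg hg1
    refine Matrix.det_eq_neg_one_of_mul_self (by rw [← map_mul, hg, map_one]) ?_
    exact fun c hc => hg1 (hψ g c hc)
  have hr := key (r (m : ℕ)) (by rw [r_mul_r, hmm]; rfl) (by
    intro h
    rw [one_def] at h
    exact hm (by injection h))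
  have hs := key (sr 0) (sr_mul_self 0) (by rw [one_def]; intro h; cases h)
  have hrs := key (r (m : ℕ) * sr 0) (by rw [r_mul_sr, sr_mul_self]) (by
    rw [one_def, r_mul_sr]; intro h; cases h)
  rw [map_mul, Matrix.det_mul, hr, hs] at hrs
  exact Ring.two_ne_zero h2 (by linear_combination hrs)

/-- A reflection inverts the rotation `A`, so `det A ^ 2 = 1`, and `n` odd gives `det A = 1`. An
eigenvalue `ζ` of `A` then satisfies `ζ + ζ⁻¹ = tr A`, and it remains to see that its order is
exactly `n`. -/
theorem zetaAddInvMem_of_hasProjFaithfulRep_dihedral (hodd : Odd n)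
    (hchar : ¬ ringChar K ∣ n) (h : HasProjFaithfulRep K (DihedralGroup n)) :
    EssDim.ZetaAddInvMem K n := by
  obtain ⟨ψ, hψ⟩ := h
  have hnK : (n : K) ≠ 0 := fun h0 => hchar ((ringChar.spec K n).mp h0)
  set A := ψ (r 1) with hA
  have hAn : A ^ n = 1 := by rw [hA, ← map_pow, r_one_pow_n, map_one]
  have hdet : A.det = 1 := by
    have h1 : A.det * (ψ (sr 0)).det * A.det = (ψ (sr 0)).det := by
      rw [← Matrix.det_mul, ← Matrix.det_mul, hA, ← map_mul, ← map_mul]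
      congr 2
      simp
    have h2 : (ψ (sr 0)).det * (ψ (sr 0)).det = 1 := by
      rw [← Matrix.det_mul, ← map_mul, sr_mul_self, map_one, Matrix.det_one]
    have h3 : A.det ^ 2 = 1 := by
      linear_combination (ψ (sr 0)).det * h1 + (1 - A.det ^ 2) * h2
    have h4 : A.det ^ n = 1 := by rw [← Matrix.det_pow, hAn, Matrix.det_one]
    obtain ⟨k, rfl⟩ := hodd
    rwa [pow_succ, pow_mul, h3, one_pow, one_mul] at h4
  let F := AlgebraicClosure K
  let i : K →+* F := algebraMap K F
  obtain ⟨ζ, hζ⟩ : ∃ ζ : F, ζ * ζ - i A.trace * ζ + 1 = 0 := by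
    obtain ⟨ζ, hζ⟩ := IsAlgClosed.exists_root
      (Polynomial.X ^ 2 - Polynomial.C (i A.trace) * Polynomial.X + 1 : Polynomial F) (by
        have : (Polynomial.X ^ 2 - Polynomial.C (i A.trace) * Polynomial.X + 1 : Polynomial F)
          = Polynomial.C 1 * Polynomial.X ^ 2 + Polynomial.C (-i A.trace) * Polynomial.X
            + Polynomial.C 1 := by simp; ring
        rw [this, Polynomial.degree_quadratic one_ne_zero]
        decide)
    refine ⟨ζ, ?_⟩
    simpa [Polynomial.IsRoot, pow_two] using hζ
  have hζ0 : ζ ≠ 0 := by rintro rfl; simp at hζ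
  refine ⟨ζ, ⟨?_, ?_⟩, A.trace, ?_⟩
  rotate_left 2
  · field_simp
    linear_combination -hζ
  all_goals
    have hAF : ∀ k : ℕ, ∃ v : Fin 2 → F, v ≠ 0 ∧
        ((A.map i) ^ k).mulVec v = ζ ^ k • v := by
      have hd : (A.map i - ζ • 1).det = 0 := by
        have hdF : i (A.det) = 1 := by rw [hdet, map_one]
        rw [Matrix.det_fin_two] at hdF ⊢
        simp only [Matrix.trace_fin_two, map_add, map_sub, map_mul] at hζ hdF
        simp
        linear_combination hζ + hdF
      obtain ⟨v, hv, hv0⟩ := Matrix.exists_mulVec_eq_zero_iff.mpr hd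
      rw [Matrix.sub_mulVec, sub_eq_zero, Matrix.smul_mulVec, Matrix.one_mulVec] at hv0
      intro k
      refine ⟨v, hv, ?_⟩
      induction k with
      | zero => simp
      | succ k ih =>
        rw [pow_succ, ← Matrix.mulVec_mulVec, hv0, Matrix.mulVec_smul, ih, smul_smul, pow_succ,
          mul_comm]
    have hmap : ∀ k : ℕ, (A.map i) ^ k = (A ^ k).map i := fun k =>
      (map_pow i.mapMatrix A k).symm
  · obtain ⟨v, hv, hv0⟩ := hAF n
    rw [hmap, hAn, Matrix.map_one _ (map_zero i) (map_one i), Matrix.one_mulVec] at hv0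
    have : (1 - ζ ^ n) • v = 0 := by rw [sub_smul, ← hv0, one_smul, sub_self]
    rcases smul_eq_zero.mp this with h | h
    · exact (sub_eq_zero.mp h).symm
    · exact absurd h hv
  · intro k hk
    obtain ⟨v, hv, hv0⟩ := hAF k
    rw [hk, one_smul, hmap] at hv0
    have hd : ((A ^ k).map i - 1).det = 0 := by
      refine Matrix.exists_mulVec_eq_zero_iff.mp ⟨v, hv, ?_⟩
      rw [Matrix.sub_mulVec, hv0, Matrix.one_mulVec, sub_self]
    have hd' : (A ^ k - 1).det = 0 := by
      apply i.injective
      rw [map_zero, ← hd, RingHom.map_det]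
      congr 1
      rw [map_sub, map_one]
      rfl
    -- If `ζ ^ k = 1`, then `C` has determinant 1 and eigenvalue 1, so it is unipotent; as `C ^ n =
    -- 1` with `n` invertible in `K`, it is the identity.
    set C := A ^ k with hC
    have hdC : C.det = 1 := by rw [hC, Matrix.det_pow, hdet, one_pow]
    have htC : C.trace = 2 := by
      rw [Matrix.det_fin_two] at hdC hd'
      rw [Matrix.trace_fin_two]
      simp at hd'
      linear_combination hdC - hd'
    have hsq : (C - 1) * (C - 1) = 0 := by
      have := C.mul_self_fin_two
      rw [htC, hdC, one_smul, two_smul] at this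
      rw [sub_mul, mul_sub, this, mul_one, one_mul]
      abel
    have h1 := one_add_nilpotent_pow hsq n
    rw [add_sub_cancel, hC, ← pow_mul, mul_comm, pow_mul, hAn, one_pow, ← hC,
      left_eq_add, ← Nat.cast_smul_eq_nsmul K] at h1
    have hC1 : C = 1 := by simpa [hnK, sub_eq_zero] using h1
    have h3 : (r 1 : DihedralGroup n) ^ k = 1 := by
      refine hψ _ 1 ?_
      rw [map_pow, one_smul, ← hC1, hC]
    rw [← orderOf_dvd_iff_pow_eq_one, orderOf_r_one] at h3
    exact h3

/-- If `p = char K` divides `n`, then all elements of `Dₙ` that commute with a rotation of order `p`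
act by matrices `α + β N` with `N` square-zero. -/
theorem exists_squareZero_of_char_dvd {p : ℕ} [hp : Fact p.Prime] [CharP K p] (hn : 1 ≤ n)
    (hpn : p ∣ n) (ψ : DihedralGroup n →* Matrix (Fin 2) (Fin 2) K)
    (hψ : ∀ (g : DihedralGroup n) (c : K), ψ g = c • 1 → g = 1) :
    ∃ N : Matrix (Fin 2) (Fin 2) K, N * N = 0 ∧
      ∀ g, Commute g (r ((n / p : ℕ) : ZMod n)) → ∃ α β : K, ψ g = α • 1 + β • N := by
  obtain ⟨m, rfl⟩ := hpn
  rw [Nat.mul_div_cancel_left _ hp.out.pos]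
  set u := ψ (r (m : ℕ)) with hu
  have hup : u ^ p = 1 := by
    rw [hu, ← map_pow, r_pow, ← Nat.cast_mul, mul_comm m p, ZMod.natCast_self, r_zero, map_one]
  refine ⟨u - 1, Matrix.sub_one_mul_self_of_pow_char hup, fun g hg => ?_⟩
  refine Matrix.exists_eq_smul_one_add_smul ?_ ?_
  · intro c hc
    have h1 := hψ (r (m : ℕ)) (c + 1) (by rw [← hu, add_smul, one_smul, ← hc, sub_add_cancel])
    rw [one_def] at h1
    have h2 : ((m : ℕ) : ZMod (p * m)) = 0 := by injection h1
    rw [ZMod.natCast_eq_zero_iff] at h2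
    have hm : 0 < m := Nat.pos_of_ne_zero (by rintro rfl; simp at hn)
    have := Nat.le_of_dvd hm h2
    have := hp.out.two_le
    nlinarith
  · have : ψ g * u = u * ψ g := by rw [hu, ← map_mul, ← map_mul, hg.eq]
    rw [mul_sub, sub_mul, this, mul_one, one_mul]

theorem smul_one_add_smul_pow_char {p : ℕ} [hp : Fact p.Prime] [CharP K p]
    {N : Matrix (Fin 2) (Fin 2) K} (hN : N * N = 0) (α β : K) :
    (α • (1 : Matrix (Fin 2) (Fin 2) K) + β • N) ^ p = α ^ p • 1 := by
  rw [add_pow_char_of_commute]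
  · rw [smul_pow, one_pow, smul_pow]
    obtain ⟨k, hk⟩ := Nat.exists_eq_add_of_le hp.out.two_le
    have : N ^ p = 0 := by rw [hk, pow_add, pow_two, hN, zero_mul]
    rw [this, smul_zero, add_zero]
  · exact (Commute.one_left _).smul_left _

/-- The generating rotation commutes with the one of order `p`, so its `p`-th power acts by a scalar
and is trivial. -/
theorem dvd_char_of_hasProjFaithfulRep_dihedral {p : ℕ} [hp : Fact p.Prime] [CharP K p]
    (hn : 1 ≤ n) (hpn : p ∣ n) (h : HasProjFaithfulRep K (DihedralGroup n)) : n = p := by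
  obtain ⟨ψ, hψ⟩ := h
  obtain ⟨N, hN, hcomm⟩ := exists_squareZero_of_char_dvd hn hpn ψ hψ
  obtain ⟨α, β, hαβ⟩ := hcomm (r 1) (by simp [Commute, SemiconjBy, add_comm])
  have h1 : (r 1 : DihedralGroup n) ^ p = 1 := by
    refine hψ _ (α ^ p) ?_
    rw [map_pow, hαβ, smul_one_add_smul_pow_char hN]
  rw [← orderOf_dvd_iff_pow_eq_one, orderOf_r_one] at h1
  exact Nat.dvd_antisymm h1 hpn

/-- The group is commutative of exponent two, so every element acts as `1 + β N` for one fixed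
square-zero `N`; the four values of `β` are distinct. -/
theorem four_le_card_of_hasProjFaithfulRep_dihedral_two [CharP K 2]
    (h : HasProjFaithfulRep K (DihedralGroup 2)) : 4 ≤ Cardinal.mk K := by
  obtain ⟨ψ, hψ⟩ := h
  have : Fact (Nat.Prime 2) := ⟨Nat.prime_two⟩
  obtain ⟨N, hN, hcomm⟩ := exists_squareZero_of_char_dvd one_le_two (dvd_refl 2) ψ hψ
  have hex : ∀ g : DihedralGroup 2, ∃ β : K, ψ g = 1 + β • N := by
    intro g
    obtain ⟨α, β, hαβ⟩ := hcomm g (by revert g; unfold Commute SemiconjBy; decide)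
    have hg : ∀ g : DihedralGroup 2, g ^ 2 = 1 := by decide
    have h1 : ψ g ^ 2 = 1 := by rw [← map_pow, hg, map_one]
    rw [hαβ, smul_one_add_smul_pow_char hN] at h1
    have h2 : α ^ 2 = 1 := by simpa using congrFun (congrFun h1 0) 0
    have h3 : α = 1 := by
      have : (α - 1) ^ 2 = 0 := by rw [sub_pow_char, h2]; simp
      exact sub_eq_zero.mp (eq_zero_of_pow_eq_zero this)
    exact ⟨β, by rw [hαβ, h3, one_smul]⟩
  choose β hβ using hex
  have hinj : Function.Injective β := by
    intro g g' hgg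
    have h1 : ψ (g * g'⁻¹) = 1 := by
      rw [map_mul, hβ g, hgg, ← hβ g', ← map_mul, mul_inv_cancel, map_one]
    exact mul_inv_eq_one.mp (hψ _ 1 (by rw [h1, one_smul]))
  have := Cardinal.lift_mk_le_lift_mk_of_injective hinj
  rw [Cardinal.mk_fintype, DihedralGroup.card, Cardinal.lift_natCast] at this
  simpa using this

end DihedralNecessity

/-! ### Dihedral groups: explicit representations -/

section DihedralSufficiency

open DihedralGroup

variable {K : Type*} [Field K] {n : ℕ}

theorem pow_val_add_pow_val {M : Type*} [Monoid M] [NeZero n] {A : M} (hA : A ^ n = 1)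
    (i j : ZMod n) : A ^ i.val * A ^ j.val = A ^ (i + j).val := by
  rw [← pow_add, ZMod.val_add, ← pow_eq_pow_mod _ hA]

theorem pow_mul_mul_pow_eq {M : Type*} [Monoid M] {A B : M} (hAB : A * B * A = B) (k : ℕ) :
    A ^ k * B * A ^ k = B := by
  induction k with
  | zero => simp
  | succ k ih =>
    calc A ^ (k + 1) * B * A ^ (k + 1) = A ^ k * (A * B * A) * A ^ k := by
          rw [pow_succ A k]
          nth_rewrite 2 [← pow_succ]
          rw [pow_succ' A k]
          simp only [mul_assoc]
      _ = B := by rw [hAB, ih]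

/-- The homomorphism from the dihedral group attached to two elements that satisfy its relations. -/
def dihedralLift {M : Type*} [Monoid M] [NeZero n] (A B : M) (hA : A ^ n = 1) (hB : B * B = 1)
    (hAB : A * B * A = B) : DihedralGroup n →* M where
  toFun
    | r i => A ^ i.val
    | sr i => B * A ^ i.val
  map_one' := by
    change A ^ (0 : ZMod n).val = 1
    simp
  map_mul' := by
    have h : ∀ i j : ZMod n, A ^ j.val = A ^ i.val * A ^ (j - i).val := fun i j => by
      rw [pow_val_add_pow_val hA, add_sub_cancel]
    rintro (i | i) (j | j)
    · exact (pow_val_add_pow_val hA i j).symm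
    · change B * A ^ (j - i).val = A ^ i.val * (B * A ^ j.val)
      rw [h i j, ← mul_assoc, ← mul_assoc, pow_mul_mul_pow_eq hAB]
    · change B * A ^ (i + j).val = B * A ^ i.val * A ^ j.val
      rw [mul_assoc, pow_val_add_pow_val hA]
    · change A ^ (j - i).val = B * A ^ i.val * (B * A ^ j.val)
      rw [h i j]
      calc A ^ (j - i).val = B * (A ^ i.val * B * A ^ i.val) * A ^ (j - i).val := by
            rw [pow_mul_mul_pow_eq hAB, hB, one_mul]
        _ = _ := by simp only [mul_assoc]

theorem hasProjFaithfulRep_dihedral_of_matrices (hn : 1 ≤ n) (A B : Matrix (Fin 2) (Fin 2) K)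
    (hA : A ^ n = 1) (hB : B * B = 1) (hAB : A * B * A = B)
    (hA' : ∀ k < n, ∀ c : K, A ^ k = c • 1 → k = 0)
    (hB' : ∀ k < n, ∀ c : K, B * A ^ k ≠ c • 1) : HasProjFaithfulRep K (DihedralGroup n) := by
  have : NeZero n := ⟨by omega⟩
  refine ⟨dihedralLift A B hA hB hAB, ?_⟩
  rintro (i | i) c hc
  · rw [(ZMod.val_eq_zero i).mp (hA' _ (ZMod.val_lt i) c hc), r_zero]
  · exact absurd hc (hB' _ (ZMod.val_lt i) c)

/-- Reflections need no check when `n ≥ 3`: a scalar `B * A ^ k` would commute with `A`, and the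
dihedral relation would force `A ^ 2 = 1`. -/
theorem hasProjFaithfulRep_dihedral_of_three_le (hn : 3 ≤ n) (A B : Matrix (Fin 2) (Fin 2) K)
    (hA : A ^ n = 1) (hB : B * B = 1) (hAB : A * B * A = B)
    (hA' : ∀ k < n, ∀ c : K, A ^ k = c • 1 → k = 0) :
    HasProjFaithfulRep K (DihedralGroup n) := by
  refine hasProjFaithfulRep_dihedral_of_matrices (by omega) A B hA hB hAB hA' fun k hk c hc => ?_
  have h1 : A * (B * A ^ k) = B * A ^ k * A := by rw [hc]; simp
  have h2 : B * A ^ k = B * A ^ k * A ^ 2 := by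
    calc B * A ^ k = (A * B * A) * A ^ k := by rw [hAB]
      _ = A * (B * A ^ k) * A := by
        rw [mul_assoc, mul_assoc, ← pow_succ', pow_succ, mul_assoc, mul_assoc]
      _ = _ := by rw [h1, mul_assoc, pow_two]
  have hu : IsUnit (B * A ^ k) :=
    (IsUnit.of_mul_eq_one _ hB).mul ((IsUnit.of_pow_eq_one hA (by omega)).pow k)
  have h3 : A ^ 2 = 1 := hu.mul_left_cancel (by rw [← h2, mul_one])
  exact two_ne_zero (hA' 2 (by omega) 1 (by rw [h3, one_smul]))

theorem hasProjFaithfulRep_dihedral_one : HasProjFaithfulRep K (DihedralGroup 1) := by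
  refine hasProjFaithfulRep_dihedral_of_matrices le_rfl 1 !![0, 1; 1, 0] (one_pow 1) ?_ ?_
    (fun k hk _ _ => by omega) ?_
  · rw [Matrix.mul_fin_two, Matrix.one_fin_two]; simp
  · simp
  · intro k hk c hc
    have := congrFun (congrFun hc 0) 1
    simp at this

theorem pow_unipotent_fin_two (x : K) (k : ℕ) :
    (!![1, x; 0, 1] : Matrix (Fin 2) (Fin 2) K) ^ k = !![1, k * x; 0, 1] := by
  induction k with
  | zero => rw [pow_zero, Matrix.one_fin_two]; simp
  | succ k ih =>
    rw [pow_succ, ih, Matrix.mul_fin_two]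
    simp only [Nat.cast_succ]
    congr 1
    simp
    ring

/-- The matrices are those of `x ↦ x + 1` and `x ↦ -x` on the affine line. -/
theorem hasProjFaithfulRep_dihedral_char {p : ℕ} [hp : Fact p.Prime] [CharP K p] (hp2 : p ≠ 2) :
    HasProjFaithfulRep K (DihedralGroup p) := by
  have h3 : 3 ≤ p := by
    have := hp.out.two_le
    omega
  refine hasProjFaithfulRep_dihedral_of_three_le h3 !![1, 1; 0, 1] !![-1, 0; 0, 1] ?_ ?_ ?_ ?_
  · rw [pow_unipotent_fin_two, CharP.cast_eq_zero, Matrix.one_fin_two, zero_mul]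
  · rw [Matrix.mul_fin_two, Matrix.one_fin_two]; simp
  · rw [Matrix.mul_fin_two, Matrix.mul_fin_two]; simp
  · intro k hk c hc
    rw [pow_unipotent_fin_two] at hc
    have h := congrFun (congrFun hc 0) 1
    simp at h
    rw [CharP.cast_eq_zero_iff K p] at h
    exact Nat.eq_zero_of_dvd_of_lt h hk

/-- The translations by `1` and `x` generate a Klein four-group as soon as `x ≠ 0, 1`. -/
theorem hasProjFaithfulRep_dihedral_two [CharP K 2] (hK : 4 ≤ Cardinal.mk K) :
    HasProjFaithfulRep K (DihedralGroup 2) := by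
  classical
  obtain ⟨x, hx0, hx1⟩ : ∃ x : K, x ≠ 0 ∧ x ≠ 1 := by
    by_contra! h
    have h1 : Function.Injective (fun x : K => if x = 0 then (0 : Fin 2) else 1) := by
      intro x y hxy
      by_cases hx : x = 0 <;> by_cases hy : y = 0 <;> simp [hx, hy] at hxy
      · rw [hx, hy]
      · rw [h x hx, h y hy]
    have h2 := Cardinal.lift_mk_le_lift_mk_of_injective h1
    simp only [Cardinal.mk_fintype, Fintype.card_fin, Cardinal.lift_natCast] at h2
    have h3 : (4 : Cardinal) ≤ 2 := hK.trans (by simpa using h2)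
    norm_num at h3
  refine hasProjFaithfulRep_dihedral_of_matrices one_le_two !![1, 1; 0, 1] !![1, x; 0, 1]
    ?_ ?_ ?_ ?_ ?_
  · rw [pow_unipotent_fin_two, CharP.cast_eq_zero, Matrix.one_fin_two, zero_mul]
  · rw [Matrix.mul_fin_two, Matrix.one_fin_two]; simp [CharTwo.add_self_eq_zero]
  · rw [Matrix.mul_fin_two, Matrix.mul_fin_two]
    simp [add_comm x 1, ← add_assoc, CharTwo.add_self_eq_zero]
  · intro k hk c hc
    rw [pow_unipotent_fin_two] at hc
    have h := congrFun (congrFun hc 0) 1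
    simp at h
    rw [CharP.cast_eq_zero_iff K 2] at h
    exact Nat.eq_zero_of_dvd_of_lt h hk
  · intro k hk c hc
    rw [pow_unipotent_fin_two, Matrix.mul_fin_two] at hc
    have h := congrFun (congrFun hc 0) 1
    simp at h
    interval_cases k
    · exact hx0 (by simpa using h)
    · exact hx1 (by rw [← CharTwo.add_eq_zero, add_comm]; simpa using h)

/-- The rotation is the companion matrix of `X² - θX + 1`, with eigenvalues `ζ` and `η = ζ⁻¹`;
swapping the coordinates inverts it. -/
theorem hasProjFaithfulRep_dihedral_of_odd (hodd : Odd n) (h : EssDim.ZetaAddInvMem K n) :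
    HasProjFaithfulRep K (DihedralGroup n) := by
  obtain ⟨ζ, hζ, θ, hθ⟩ := h
  by_cases hn1 : n = 1
  · subst hn1
    exact hasProjFaithfulRep_dihedral_one
  have hn : 3 ≤ n := by
    obtain ⟨k, rfl⟩ := hodd
    omega
  set i := algebraMap K (AlgebraicClosure K)
  have hζ0 : ζ ≠ 0 := hζ.ne_zero (by omega)
  set η := ζ⁻¹ with hη
  have hζη : ζ * η = 1 := mul_inv_cancel₀ hζ0
  have hηn : η ^ n = 1 := by rw [hη, inv_pow, hζ.pow_eq_one, inv_one]
  have hdvd : ∀ k, ζ ^ k = η ^ k → n ∣ k := by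
    intro k hk
    have h1 : ζ ^ (2 * k) = 1 := by
      rw [two_mul, pow_add]
      nth_rewrite 2 [hk]
      rw [← mul_pow, hζη, one_pow]
    have h2 := hζ.dvd_of_pow_eq_one _ h1
    exact (Nat.Coprime.symm hodd.coprime_two_left).dvd_of_dvd_mul_left h2
  have hne : ζ - η ≠ 0 := by
    intro h0
    have := Nat.le_of_dvd one_pos (hdvd 1 (by simpa using sub_eq_zero.mp h0))
    omega
  set A : Matrix (Fin 2) (Fin 2) K := !![0, -1; 1, θ] with hA
  have hAA : A * A = θ • A - 1 := by
    rw [hA, Matrix.mul_fin_two, Matrix.one_fin_two]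
    simp
    ring
  set A' := i.mapMatrix A with hA'
  have hAA' : A' * A' = (ζ + η) • A' - 1 := by
    rw [hA', ← map_mul, hAA, map_sub, map_one, ← hθ]
    congr 1
    ext a b
    simp
  -- Closed form of the recurrence given by Cayley–Hamilton, with the denominator `ζ - η` cleared.
  have hpow : ∀ k, (ζ - η) • A' ^ (k + 1) =
      (ζ ^ (k + 1) - η ^ (k + 1)) • A' - (ζ ^ k - η ^ k) • 1 := by
    intro k
    induction k with
    | zero => simp
    | succ k ih =>
      rw [pow_succ, ← smul_mul_assoc, ih, sub_mul, smul_mul_assoc, hAA', smul_mul_assoc, one_mul,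
        smul_sub, smul_smul, sub_right_comm, ← sub_smul]
      congr 2
      linear_combination (ζ ^ k - η ^ k) * hζη
  have hAn' : A' ^ n = 1 := by
    obtain ⟨k, rfl⟩ := Nat.exists_eq_succ_of_ne_zero (show n ≠ 0 by omega)
    have h1 := hpow k
    have h2 : ζ ^ k = η := by
      have := hζ.pow_eq_one
      rw [Nat.succ_eq_add_one, pow_succ] at this
      linear_combination η * this - ζ ^ k * hζη
    have h3 : η ^ k = ζ := by
      rw [Nat.succ_eq_add_one, pow_succ] at hηn
      linear_combination ζ * hηn - η ^ k * hζη
    have h4 := hζ.pow_eq_one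
    rw [Nat.succ_eq_add_one] at h4 hηn
    rw [h4, hηn, h2, h3, sub_self, zero_smul, zero_sub, ← neg_smul, neg_sub] at h1
    exact smul_right_injective _ hne h1
  refine hasProjFaithfulRep_dihedral_of_three_le hn A !![0, 1; 1, 0] ?_ ?_ ?_ ?_
  · have : Function.Injective (i.mapMatrix : Matrix (Fin 2) (Fin 2) K →+* _) :=
      Matrix.map_injective i.injective
    apply this
    rw [map_pow, map_one, hAn']
  · rw [Matrix.mul_fin_two, Matrix.one_fin_two]; simp
  · rw [hA, Matrix.mul_fin_two, Matrix.mul_fin_two]; simp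
  · intro k hk c hc
    by_contra hk0
    obtain ⟨m, rfl⟩ := Nat.exists_eq_succ_of_ne_zero hk0
    have h1 := hpow m
    rw [hA', ← map_pow, hc] at h1
    -- In this entry `A` is 1 and scalar matrices vanish, which leaves `ζ ^ (m + 1) = η ^ (m + 1)`.
    have h2 := congrFun (congrFun h1 1) 0
    simp [hA] at h2
    have := Nat.le_of_dvd (Nat.succ_pos m) (hdvd _ (sub_eq_zero.mp h2.symm))
    omega

end DihedralSufficiency

theorem hasProjFaithfulRep_dihedral_iff {K : Type*} [Field K] {n : ℕ} (hn : 1 ≤ n) :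
    (ringChar K ≠ 2 →
      (HasProjFaithfulRep K (DihedralGroup n) ↔
        Odd n ∧ (¬ ringChar K ∣ n → EssDim.ZetaAddInvMem K n) ∧
          (ringChar K ∣ n → n = ringChar K))) ∧
    (ringChar K = 2 →
      (HasProjFaithfulRep K (DihedralGroup n) ↔
        (Odd n → EssDim.ZetaAddInvMem K n) ∧ (Even n → 4 ≤ Cardinal.mk K ∧ n = 2))) := by
  -- Characteristic zero falls under `¬ ringChar K ∣ n`, since `0 ∣ n` would force `n = 0`.
  have hprime : ringChar K ∣ n → Fact (ringChar K).Prime := fun hd =>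
    ⟨(CharP.char_is_prime_or_zero K (ringChar K)).resolve_right fun h0 => by
      rw [h0, zero_dvd_iff] at hd
      omega⟩
  refine ⟨fun h2 => ⟨fun h => ?_, fun ⟨hodd, hz, hp⟩ => ?_⟩, fun h2 => ?_⟩
  · have hodd := odd_of_hasProjFaithfulRep_dihedral hn h2 h
    refine ⟨hodd, fun hd => zetaAddInvMem_of_hasProjFaithfulRep_dihedral hodd hd h, fun hd => ?_⟩
    have := hprime hd
    exact dvd_char_of_hasProjFaithfulRep_dihedral hn hd h
  · by_cases hd : ringChar K ∣ n
    · have := hprime hd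
      have h := hasProjFaithfulRep_dihedral_char (K := K) h2
      rwa [← hp hd] at h
    · exact hasProjFaithfulRep_dihedral_of_odd hodd (hz hd)
  · have : CharP K 2 := by rw [← h2]; exact ringChar.charP K
    have : Fact (Nat.Prime 2) := ⟨Nat.prime_two⟩
    refine ⟨fun h => ⟨fun hodd => ?_, fun heven => ?_⟩, fun ⟨hz, he⟩ => ?_⟩
    · refine zetaAddInvMem_of_hasProjFaithfulRep_dihedral hodd ?_ h
      rw [h2]
      exact hodd.not_two_dvd_nat
    · have hn2 : n = 2 := dvd_char_of_hasProjFaithfulRep_dihedral hn heven.two_dvd h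
      subst hn2
      exact ⟨four_le_card_of_hasProjFaithfulRep_dihedral_two h, rfl⟩
    · rcases Nat.even_or_odd n with hev | hodd
      · obtain ⟨hK, rfl⟩ := he hev
        exact hasProjFaithfulRep_dihedral_two hK
      · exact hasProjFaithfulRep_dihedral_of_odd hodd (hz hodd)

/-! ### Essential dimension through faithful stable subfields -/

section FaithfulStable

open IntermediateField

variable {K L : Type*} [Field K] [Field L] [Algebra K L]

/-- The intermediate field `E` is stable under `H`, and `H` acts faithfully on it. -/
def IsFaithfulStable (H : Subgroup (L ≃ₐ[K] L)) (E : IntermediateField K L) : Prop :=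
  (∀ σ ∈ H, ∀ x ∈ E, σ x ∈ E) ∧ ∀ σ ∈ H, (∀ x ∈ E, σ x = x) → σ = 1

variable {H : Subgroup (L ≃ₐ[K] L)}

instance isGaloisGroup_fixedField_subgroup [Finite H] : IsGaloisGroup H (fixedField H) L :=
  inferInstanceAs (IsGaloisGroup H (FixedPoints.subfield H L) L)

/-- The field `E` over `E₀` need not be stable, but the algebraic closure of `E₀` in `L` is, because
`H` fixes `E₀`. It contains `E`, so an automorphism in `H` trivial on it fixes `E` and `L₀`, hence
`L = E L₀`. -/
theorem isFaithfulStable_algebraicClosure [Finite H] {E₀ : IntermediateField K L}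
    (h : EssDim.IsDefinedOver (fixedField H) E₀) :
    IsFaithfulStable H ((algebraicClosure E₀ L).restrictScalars K) := by
  obtain ⟨h0, E, hE, hfin, hsup⟩ := h
  have hfix : ∀ σ ∈ H, ∀ x ∈ E₀, σ x = x := fun σ hσ x hx => h0 hx ⟨σ, hσ⟩
  -- `finrank` is 0 for infinite extensions; here it equals the order of `H`.
  have hfd : FiniteDimensional E₀ (extendScalars hE) := by
    refine FiniteDimensional.of_finrank_pos ?_
    rw [hfin, ← IsGaloisGroup.card_eq_finrank H]
    exact Nat.card_pos
  refine ⟨fun σ hσ x hx => ?_, fun σ hσ hx => ?_⟩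
  · rw [mem_restrictScalars, mem_algebraicClosure_iff] at hx ⊢
    let τ : L →ₐ[E₀] L := { (σ : L →+* L) with commutes' := fun y => hfix σ hσ y y.2 }
    exact hx.algHom τ
  · have hle : E ⊔ fixedField H ≤ fixedField (Subgroup.zpowers σ) := by
      refine sup_le (fun x hxE => ?_) fun x hxL => ?_
      · have hxa : σ x = x := by
          refine hx x ?_
          rw [mem_restrictScalars, mem_algebraicClosure_iff]
          have := (Algebra.IsAlgebraic.of_finite E₀ (extendScalars hE)).isAlgebraic ⟨x, hxE⟩
          exact this.algHom (extendScalars hE).val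
        exact fun ⟨τ, hτ⟩ => by
          change σ ∈ MulAction.stabilizer (L ≃ₐ[K] L) x at hxa
          exact (Subgroup.zpowers_le.mpr hxa) hτ
      · exact fun ⟨τ, hτ⟩ => hxL ⟨τ, (Subgroup.zpowers_le.mpr hσ) hτ⟩
    rw [hsup, top_le_iff] at hle
    ext x
    have : x ∈ fixedField (Subgroup.zpowers σ) := hle ▸ mem_top
    exact this ⟨σ, Subgroup.mem_zpowers σ⟩

theorem trdeg_eq_of_isAlgebraic.{u} (F : Type*) (M N : Type u) [Field F] [Field M] [Field N]
    [Algebra F M] [Algebra F N] [Algebra M N] [IsScalarTower F M N] [Algebra.IsAlgebraic M N] :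
    Algebra.trdeg F M = Algebra.trdeg F N := by
  rw [← trdeg_add_eq F M (A := N), trdeg_eq_zero (R := M), add_zero]

theorem trdeg_restrictScalars_algebraicClosure (E₀ : IntermediateField K L) :
    Algebra.trdeg K ((algebraicClosure E₀ L).restrictScalars K) = Algebra.trdeg K E₀ := by
  exact (trdeg_eq_of_isAlgebraic K E₀ (algebraicClosure E₀ L)).symm

/-- The action of `H` on a stable intermediate field. -/
@[reducible] def stableAction {E : IntermediateField K L} (hE : ∀ σ ∈ H, ∀ x ∈ E, σ x ∈ E) :
    MulSemiringAction H E where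
  smul σ x := ⟨σ.1 x, hE σ.1 σ.2 x x.2⟩
  one_smul _ := rfl
  mul_smul _ _ _ := rfl
  smul_zero σ := Subtype.ext (map_zero σ.1)
  smul_add σ x y := Subtype.ext (map_add σ.1 x.1 y.1)
  smul_one σ := Subtype.ext (map_one σ.1)
  smul_mul σ x y := Subtype.ext (map_mul σ.1 x.1 y.1)

theorem isGaloisGroup_stable {E : IntermediateField K L} (hE : IsFaithfulStable H E) :
    letI := stableAction hE.1
    letI := (inclusion (inf_le_left : E ⊓ fixedField H ≤ E)).toRingHom.toAlgebra
    IsGaloisGroup H (E ⊓ fixedField H : IntermediateField K L) E := by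
  let _ := stableAction hE.1
  let _ := (inclusion (inf_le_left : E ⊓ fixedField H ≤ E)).toRingHom.toAlgebra
  refine ⟨⟨fun {σ τ} hστ => ?_⟩, ⟨fun σ a x => ?_⟩, ⟨fun x hx => ?_⟩⟩
  · have h1 : (τ⁻¹ * σ).1 = 1 := by
      refine hE.2 _ (τ⁻¹ * σ).2 fun x hx => ?_
      have h2 : σ.1 x = τ.1 x := congrArg Subtype.val (hστ ⟨x, hx⟩)
      change (τ.1)⁻¹ (σ.1 x) = x
      rw [h2]
      exact τ.1.symm_apply_apply x
    exact (inv_mul_eq_one.mp (Subtype.ext h1)).symm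
  · apply Subtype.ext
    change σ.1 (a.1 * x.1) = a.1 * σ.1 x.1
    rw [map_mul]
    congr 1
    exact a.2.2 σ
  · refine ⟨⟨x.1, x.2, fun σ => ?_⟩, rfl⟩
    exact congrArg Subtype.val (hx σ)

/-- Artin's theorem gives both extensions degree `|H|`. By faithfulness only the identity fixes `E ⊔
fixedField H`, so the Galois correspondence makes it all of `L`. -/
theorem isDefinedOver_of_isFaithfulStable [Finite H] {E : IntermediateField K L}
    (hE : IsFaithfulStable H E) : EssDim.IsDefinedOver (fixedField H) (E ⊓ fixedField H) := by
  refine ⟨inf_le_right, E, inf_le_left, ?_, ?_⟩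
  · rw [← IsGaloisGroup.card_eq_finrank H (fixedField H) L]
    let _ := stableAction hE.1
    let _ := (inclusion (inf_le_left : E ⊓ fixedField H ≤ E)).toRingHom.toAlgebra
    have := isGaloisGroup_stable hE
    have h := IsGaloisGroup.card_eq_finrank H (E ⊓ fixedField H : IntermediateField K L) E
    exact h.symm
  · have hfd : FiniteDimensional (fixedField H) L := IsGaloisGroup.finiteDimensional H _ _
    have hgal : IsGalois (fixedField H) L := IsGaloisGroup.isGalois H _ _
    have hle : fixedField H ≤ E ⊔ fixedField H := le_sup_right
    have h1 : (extendScalars hle).fixingSubgroup = ⊥ := by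
      rw [eq_bot_iff]
      intro τ hτ
      obtain ⟨σ, rfl⟩ := (IsGaloisGroup.mulEquivAlgEquiv H (fixedField H) L).surjective τ
      have h2 : σ.1 = 1 := by
        refine hE.2 _ σ.2 fun x hx => ?_
        exact hτ ⟨x, le_sup_left (a := E) hx⟩
      rw [Subgroup.mem_bot, show σ = 1 from Subtype.ext h2, map_one]
    have h3 : extendScalars hle = ⊤ := by
      rw [← IsGalois.fixedField_fixingSubgroup (extendScalars hle), h1, fixedField_bot]
    rw [eq_top_iff]
    intro x _
    have : x ∈ extendScalars hle := h3 ▸ mem_top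
    exact this

theorem trdeg_inf_fixedField [Finite H] {E : IntermediateField K L}
    (hE : IsFaithfulStable H E) :
    Algebra.trdeg K (E ⊓ fixedField H : IntermediateField K L) = Algebra.trdeg K E := by
  let _ := stableAction hE.1
  let _ := (inclusion (inf_le_left : E ⊓ fixedField H ≤ E)).toRingHom.toAlgebra
  have := isGaloisGroup_stable hE
  have : FiniteDimensional (E ⊓ fixedField H : IntermediateField K L) E :=
    IsGaloisGroup.finiteDimensional H _ _
  have : IsScalarTower K (E ⊓ fixedField H : IntermediateField K L) E :=
    IsScalarTower.of_algebraMap_eq fun _ => rfl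
  exact trdeg_eq_of_isAlgebraic K (E ⊓ fixedField H : IntermediateField K L) E

/-- Degree zero is excluded: such an `E` would lie in `K`, where `H` acts trivially. -/
theorem extEssDim_fixedField_eq_one_iff [Finite H] [Nontrivial H]
    (hK : ∀ x : L, IsAlgebraic K x → x ∈ (⊥ : IntermediateField K L)) :
    EssDim.extEssDim (fixedField H) = 1 ↔
      ∃ E : IntermediateField K L, IsFaithfulStable H E ∧ Algebra.trdeg K E = 1 := by
  have hpos : ∀ E : IntermediateField K L, IsFaithfulStable H E → Algebra.trdeg K E ≠ 0 := by
    intro E hE h0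
    rw [trdeg_eq_zero_iff] at h0
    obtain ⟨σ, hσ⟩ := exists_ne (1 : H)
    refine hσ (Subtype.ext (hE.2 σ.1 σ.2 fun x hx => ?_))
    obtain ⟨c, rfl⟩ := mem_bot.mp (hK x ((h0.isAlgebraic ⟨x, hx⟩).algHom E.val))
    exact AlgEquiv.commutes _ c
  constructor
  · intro h
    obtain ⟨E₀, hE₀, hd⟩ := csInf_mem ⟨_, EssDim.trdeg_mem (fixedField H)⟩
    refine ⟨_, isFaithfulStable_algebraicClosure hE₀, ?_⟩
    rw [trdeg_restrictScalars_algebraicClosure, ← hd]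
    exact h
  · rintro ⟨E, hE, hd⟩
    refine le_antisymm ?_ ?_
    · rw [← hd, ← trdeg_inf_fixedField hE]
      exact csInf_le' ⟨_, isDefinedOver_of_isFaithfulStable hE, rfl⟩
    · refine le_csInf ⟨_, EssDim.trdeg_mem (fixedField H)⟩ ?_
      rintro d ⟨E₀, hE₀, rfl⟩
      rw [Cardinal.one_le_iff_ne_zero, ← trdeg_restrictScalars_algebraicClosure]
      exact hpos _ (isFaithfulStable_algebraicClosure hE₀)

end FaithfulStable

/-! ### Restriction to a curve and Lüroth's theorem -/

section Curve

open IntermediateField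

variable {K : Type*} [Field K]

/-- Kronecker substitution: the weights are powers of an `N` larger than every exponent, so a weight
is a base-`N` expansion. -/
theorem exists_weight_injOn {m : ℕ} (S : Finset (Fin m →₀ ℕ)) :
    ∃ w : Fin m → ℕ, Set.InjOn (Finsupp.weight w) (S : Set (Fin m →₀ ℕ)) := by
  set N := 2 + S.sup fun d => Finset.univ.sup d with hN
  have hlt : ∀ d ∈ S, ∀ i, d i < N := by
    intro d hd i
    have h1 : d i ≤ Finset.univ.sup d := Finset.le_sup (Finset.mem_univ i)
    have h2 := Finset.le_sup (f := fun d : Fin m →₀ ℕ => Finset.univ.sup d) hd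
    omega
  refine ⟨fun i => N ^ (i : ℕ), fun v hv w hw h => Finsupp.ext <| congrFun <| List.ofFn_inj.mp ?_⟩
  refine Nat.ofDigits_inj_of_len_eq (b := N) (by omega) (by simp) ?_ ?_ ?_
  · intro l hl
    obtain ⟨i, rfl⟩ := List.mem_ofFn.mp hl
    exact hlt v hv i
  · intro l hl
    obtain ⟨i, rfl⟩ := List.mem_ofFn.mp hl
    exact hlt w hw i
  · rw [Finsupp.weight_apply, Finsupp.weight_apply, Finsupp.sum_fintype _ _ (by simp),
      Finsupp.sum_fintype _ _ (by simp)] at h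
    simpa only [Nat.ofDigits_eq_sum_mapIdx, List.mapIdx_eq_ofFn, List.get_ofFn, List.length_ofFn,
      Fin.val_cast, smul_eq_mul, List.sum_ofFn] using! h

/-- The substitution `xᵢ ↦ t ^ wᵢ`. -/
noncomputable def weightSubst {m : ℕ} (w : Fin m → ℕ) : MvPolynomial (Fin m) K →ₐ[K] Polynomial K :=
  MvPolynomial.aeval fun i => Polynomial.X ^ w i

theorem weightSubst_monomial {m : ℕ} (w : Fin m → ℕ) (d : Fin m →₀ ℕ) (c : K) :
    weightSubst w (MvPolynomial.monomial d c) = Polynomial.monomial (Finsupp.weight w d) c := by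
  rw [weightSubst, MvPolynomial.aeval_monomial, Finsupp.weight_apply,
    ← Polynomial.C_mul_X_pow_eq_monomial, Finsupp.sum, Finsupp.prod, ← Finset.prod_pow_eq_pow_sum]
  simp only [← pow_mul, smul_eq_mul, mul_comm]
  rfl

theorem coeff_weightSubst {m : ℕ} {w : Fin m → ℕ} {S : Finset (Fin m →₀ ℕ)}
    (hw : Set.InjOn (Finsupp.weight w) (S : Set (Fin m →₀ ℕ))) {p : MvPolynomial (Fin m) K}
    (hp : p.support ⊆ S) {d : Fin m →₀ ℕ} (hd : d ∈ S) :
    (weightSubst w p).coeff (Finsupp.weight w d) = p.coeff d := by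
  conv_lhs => rw [p.as_sum, map_sum]
  simp only [weightSubst_monomial, Polynomial.finsetSum_coeff, Polynomial.coeff_monomial]
  rw [Finset.sum_eq_single d]
  · simp
  · intro e he hne
    exact if_neg fun h => hne (hw (hp he) hd h)
  · intro h
    simpa using h

theorem weightSubst_eq_zero {m : ℕ} {w : Fin m → ℕ} {S : Finset (Fin m →₀ ℕ)}
    (hw : Set.InjOn (Finsupp.weight w) (S : Set (Fin m →₀ ℕ))) {p : MvPolynomial (Fin m) K}
    (hp : p.support ⊆ S) (h : weightSubst w p = 0) : p = 0 := by
  ext d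
  by_cases hd : d ∈ S
  · rw [← coeff_weightSubst hw hp hd, h, Polynomial.coeff_zero, MvPolynomial.coeff_zero]
  · rw [MvPolynomial.coeff_zero, ← MvPolynomial.notMem_support_iff]
    exact fun h => hd (hp h)

/-- A nonconstant rational function `a / b` remains nonconstant on some monomial curve. -/
theorem exists_algHom_polynomial {m : ℕ} (a b : MvPolynomial (Fin m) K) (hb : b ≠ 0)
    (hab : ∀ c : K, a ≠ c • b) : ∃ θ : MvPolynomial (Fin m) K →ₐ[K] Polynomial K,
      θ b ≠ 0 ∧ ∀ c : K, θ a ≠ c • θ b := by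
  classical
  -- The union of the supports contains that of `a - c • b` for every `c`, so one choice of weights
  -- serves all constants.
  obtain ⟨w, hw⟩ := exists_weight_injOn (a.support ∪ b.support)
  refine ⟨weightSubst w, fun h => hb (weightSubst_eq_zero hw Finset.subset_union_right h),
    fun c h => hab c ?_⟩
  rw [← sub_eq_zero]
  refine weightSubst_eq_zero hw ?_ (by rw [map_sub, map_smul, h, sub_self])
  exact (MvPolynomial.support_sub _ _ _).trans
    (Finset.union_subset_union_right MvPolynomial.support_smul)

/-- If nonconstant elements of the fraction field of `R` stay nonconstant on some curve
`Spec K[t] → Spec R`, then subfields of transcendence degree one of the fraction field embed into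
the rational function field in one variable. -/
theorem nonempty_algHom_ratFunc {R L : Type*} [CommRing R] [IsDomain R] [Algebra K R]
    [IsIntegrallyClosed R] [Field L] [Algebra K L] [Algebra R L] [IsScalarTower K R L]
    [IsFractionRing R L]
    (hR : ∀ a b : R, b ≠ 0 → (∀ c : K, a ≠ c • b) →
      ∃ θ : R →ₐ[K] Polynomial K, θ b ≠ 0 ∧ ∀ c : K, θ a ≠ c • θ b)
    (E : IntermediateField K L) (hE : Algebra.trdeg K E = 1) :
    Nonempty (E →ₐ[K] RatFunc K) := by
  obtain ⟨f, hf⟩ : ∃ f : E, Transcendental K f := by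
    by_contra! h
    have : Algebra.IsAlgebraic K E := ⟨fun x => by
      by_contra hx
      exact h x hx⟩
    rw [trdeg_eq_zero] at hE
    exact zero_ne_one hE
  have halg : Algebra.IsAlgebraic K⟮f⟯ E := by
    have h1 : AlgebraicIndependent K (fun _ : Unit => f) :=
      (algebraicIndependent_unique_type_iff).mpr hf
    have h2 := (h1.isTranscendenceBasis_of_lift_trdeg_le_of_finite (by simp [hE])).isAlgebraic_field
    rwa [Set.range_const] at h2
  obtain ⟨a, b, hb, hab⟩ := IsFractionRing.div_surjective R (f : L)
  have hb0 : b ≠ 0 := nonZeroDivisors.ne_zero hb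
  have hbL : algebraMap R L b ≠ 0 := by
    simpa using hb0
  obtain ⟨θ, hθb, hθ⟩ := hR a b hb0 (by
    rintro c rfl
    have : (f : L) = algebraMap K L c := by
      rw [← hab, Algebra.smul_def, map_mul, mul_div_cancel_right₀ _ hbL,
        ← IsScalarTower.algebraMap_apply]
    refine hf ?_
    rw [show f = algebraMap K E c from Subtype.ext this]
    exact isAlgebraic_algebraMap c)
  -- `S` is the complement of the prime `ker θ`, so `O` is the local ring along the curve, and `Φ`
  -- is restriction to the curve.
  let S : Submonoid R := (nonZeroDivisors (Polynomial K)).comap θ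
  have hS : S ≤ nonZeroDivisors R := by
    intro x hx
    rw [mem_nonZeroDivisors_iff_ne_zero]
    rintro rfl
    have : θ 0 ≠ 0 := nonZeroDivisors.ne_zero hx
    exact this (map_zero θ)
  have hmemS : ∀ x : R, θ x ≠ 0 → x ∈ S := fun x hx => mem_nonZeroDivisors_of_ne_zero hx
  let O := Localization.subalgebra.ofField L S hS
  have hOint : IsIntegrallyClosed O := isIntegrallyClosed_of_isLocalization O S hS
  let g : R →+* RatFunc K := (algebraMap (Polynomial K) (RatFunc K)).comp θ
  have hg : ∀ y : S, IsUnit (g y) := by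
    intro y
    rw [isUnit_iff_ne_zero]
    have : θ y ≠ 0 := nonZeroDivisors.ne_zero y.2
    exact (map_ne_zero_iff _ (RatFunc.algebraMap_injective K)).mpr this
  let Φ : O →+* RatFunc K := IsLocalization.lift hg
  have hΦ : ∀ x : R, Φ (algebraMap R O x) = g x := IsLocalization.lift_eq hg
  have hΦK : ∀ (c : K) (h : algebraMap K L c ∈ O), Φ ⟨algebraMap K L c, h⟩ = RatFunc.C c := by
    intro c h
    have : (⟨algebraMap K L c, h⟩ : O) = algebraMap R O (algebraMap K R c) :=
      Subtype.ext (IsScalarTower.algebraMap_apply K R L c)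
    rw [this, hΦ]
    change algebraMap (Polynomial K) (RatFunc K) (θ (algebraMap K R c)) = _
    rw [AlgHom.commutes]
    rfl
  have hinv : ∀ y : O, Φ y ≠ 0 → (y : L)⁻¹ ∈ O := by
    rintro ⟨y, u, v, hv, rfl⟩ hy
    have hv0 : algebraMap R L v ≠ 0 := by simpa using nonZeroDivisors.ne_zero (hS hv)
    refine ⟨v, u, hmemS u fun hu => hy ?_, by simp⟩
    have h1 : (⟨algebraMap R L u * (algebraMap R L v)⁻¹, u, v, hv, rfl⟩ : O) * algebraMap R O v =
        algebraMap R O u := by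
      apply Subtype.ext
      exact inv_mul_cancel_right₀ hv0 _
    have h2 := congrArg Φ h1
    rw [map_mul, hΦ, hΦ] at h2
    have h3 : g u = 0 := by
      change algebraMap (Polynomial K) (RatFunc K) (θ u) = 0
      rw [hu, map_zero]
    rw [h3] at h2
    exact (mul_eq_zero.mp h2).resolve_right (hg ⟨v, hv⟩).ne_zero
  have hKO : ∀ c : K, algebraMap K L c ∈ O := fun c => by
    rw [IsScalarTower.algebraMap_apply K R L]
    exact O.algebraMap_mem _
  have hfO : (f : L) ∈ O := ⟨a, b, hmemS b hθb, by rw [← hab, div_eq_mul_inv]⟩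
  let OK : Subalgebra K L := { O.toSubsemiring with algebraMap_mem' := hKO }
  let ΦK : OK →ₐ[K] RatFunc K := { Φ with commutes' := fun c => hΦK c (hKO c) }
  let fO : OK := ⟨f, hfO⟩
  have hΦf : Transcendental K (ΦK fO) := by
    refine RatFunc.transcendental_of_ne_C _ ?_
    rintro ⟨c, hc⟩
    refine hθ c ?_
    have h1 : (⟨f, hfO⟩ : O) * algebraMap R O b = algebraMap R O a := by
      apply Subtype.ext
      change (f : L) * algebraMap R L b = algebraMap R L a
      rw [← hab, div_mul_cancel₀ _ hbL]
    have h2 := congrArg Φ h1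
    rw [map_mul, hΦ, hΦ, show Φ ⟨f, hfO⟩ = RatFunc.C c from hc] at h2
    apply RatFunc.algebraMap_injective K
    rw [Polynomial.smul_eq_C_mul, map_mul, RatFunc.algebraMap_C]
    exact h2.symm
  -- Since `Φ f` is transcendental, nonzero polynomials in `f` do not vanish on the curve and are
  -- invertible in `O`.
  have hadj : ∀ x ∈ K⟮(f : L)⟯, x ∈ OK := by
    intro x hx
    obtain ⟨p, q, rfl⟩ := (mem_adjoin_simple_iff K x).mp hx
    have hmem : ∀ p : Polynomial K, Polynomial.aeval (f : L) p = (Polynomial.aeval fO p : OK) :=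
      fun p => Polynomial.aeval_algHom_apply OK.val fO p
    rw [div_eq_mul_inv]
    refine OK.mul_mem (by rw [hmem]; exact Subtype.property _) ?_
    by_cases hq : q = 0
    · simp [hq, OK.zero_mem]
    · rw [hmem]
      refine hinv (Polynomial.aeval fO q) ?_
      change ΦK (Polynomial.aeval fO q) ≠ 0
      rw [← Polynomial.aeval_algHom_apply]
      exact (transcendental_iff.mp hΦf q).mt hq
  -- `E` is algebraic over `K(f)`, hence integral over `O`, which is integrally closed.
  have hEO : ∀ x ∈ E, x ∈ OK := by
    intro x hx
    have h1 : IsIntegral K⟮f⟯ (⟨x, hx⟩ : E) := (halg.isAlgebraic _).isIntegral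
    obtain ⟨p, hp, hpx⟩ := h1
    have hmap : ∀ y : K⟮f⟯, ((y : E) : L) ∈ O := by
      intro y
      refine hadj _ ?_
      have : ((y : E) : L) ∈ (K⟮f⟯).map E.val := ⟨y, y.2, rfl⟩
      rwa [adjoin_map, Set.image_singleton] at this
    let j : K⟮f⟯ →+* O := ((algebraMap E L).comp (algebraMap K⟮f⟯ E)).codRestrict O hmap
    have h2 : IsIntegral O x := by
      refine ⟨p.map j, hp.map j, ?_⟩
      rw [Polynomial.eval₂_map]
      have h3 := congrArg (algebraMap E L) hpx
      rw [Polynomial.hom_eval₂, map_zero] at h3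
      exact h3
    obtain ⟨y, hy⟩ := IsIntegrallyClosed.algebraMap_eq_of_integral h2
    rw [← hy]
    exact y.2
  exact ⟨ΦK.comp (Subalgebra.inclusion (S := E.toSubalgebra) (T := OK) hEO)⟩

/-- An intermediate field of transcendence degree one that embeds into `K(t)` is rational. -/
theorem exists_eq_adjoin_simple_of_algHom {L : Type*} [Field L] [Algebra K L]
    {E : IntermediateField K L} (hE : Algebra.trdeg K E = 1) (j : E →ₐ[K] RatFunc K) :
    ∃ s : L, Transcendental K s ∧ E = K⟮s⟯ := by
  have hbot : j.fieldRange ≠ ⊥ := by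
    intro h
    have : Algebra.IsAlgebraic K E := ⟨fun x => by
      have hx : j x ∈ j.fieldRange := ⟨x, rfl⟩
      rw [h] at hx
      obtain ⟨c, hc⟩ := mem_bot.mp hx
      rw [show x = algebraMap K E c from j.injective ((j.commutes c).trans hc).symm]
      exact isAlgebraic_algebraMap c⟩
    rw [trdeg_eq_zero] at hE
    exact zero_ne_one hE
  obtain ⟨s, hs⟩ := RatFunc.Luroth.generator_mem (E := j.fieldRange)
  have hs' : j s = RatFunc.Luroth.generator j.fieldRange := hs
  have htr : Transcendental K s := by
    have h := RatFunc.Luroth.transcendental_generator hbot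
    rw [← hs'] at h
    exact fun h' => h (h'.algHom j)
  have hfull : ∀ x : E, x ∈ K⟮s⟯ := by
    intro x
    have h1 : j x ∈ j.fieldRange := ⟨x, rfl⟩
    rw [RatFunc.Luroth.eq_adjoin_generator (E := j.fieldRange), ← hs', ← Set.image_singleton,
      ← adjoin_map] at h1
    obtain ⟨y, hy, hyx⟩ := h1
    rwa [← j.injective hyx]
  refine ⟨s, ?_, le_antisymm (fun x hx => ?_) (adjoin_simple_le_iff.mpr s.2)⟩
  · exact fun h => htr ((isAlgebraic_algHom_iff E.val E.val.injective).mp h)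
  · have h1 : x ∈ (K⟮s⟯).map E.val := ⟨⟨x, hx⟩, hfull _, rfl⟩
    rwa [adjoin_map, Set.image_singleton] at h1

end Curve

/-! ### Möbius actions and their lift to matrices -/

section Mobius

open IntermediateField

variable {K L : Type*} [Field K] [Field L] [Algebra K L]

/-- Two generators of a purely transcendental extension of degree one differ by a Möbius
transformation. -/
theorem exists_mobius {s t : L} (hs : Transcendental K s) (hst : K⟮t⟯ = K⟮s⟯) :
    ∃ α β γ δ : K, α * δ - β * γ ≠ 0 ∧ algebraMap K L γ * s + algebraMap K L δ ≠ 0 ∧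
      t * (algebraMap K L γ * s + algebraMap K L δ) =
        algebraMap K L α * s + algebraMap K L β := by
  have htr : Transcendental K t := by
    intro ht
    have h1 := isAlgebraic_adjoin_simple ht.isIntegral
    rw [hst] at h1
    exact hs ((h1.isAlgebraic (AdjoinSimple.gen K s)).algHom K⟮s⟯.val)
  have htmem : t ∈ K⟮s⟯ := hst ▸ mem_adjoin_simple_self K t
  let e := RatFunc.algEquivOfTranscendental s hs
  set f := e.symm ⟨t, htmem⟩ with hf
  have hef : (e f : L) = t := by rw [hf, AlgEquiv.apply_symm_apply]
  have htop : K⟮f⟯ = ⊤ := by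
    rw [eq_top_iff]
    intro x _
    have h1 : (K⟮s⟯.val.comp e.toAlgHom) x ∈ K⟮t⟯ := by
      rw [hst]
      exact (e x).2
    have h2 : t = (K⟮s⟯.val.comp e.toAlgHom) f := hef.symm
    rw [h2, ← Set.image_singleton, ← adjoin_map] at h1
    obtain ⟨y, hy, hyx⟩ := h1
    rwa [← (K⟮s⟯.val.comp e.toAlgHom).injective hyx]
  -- The degree of `K(X)` over `K(f)` is the larger of the degrees of numerator and denominator;
  -- here it is 1.
  have hdeg := f.finrank_eq_max_natDegree
  rw [finrank_eq_one_iff_eq_top.mpr htop] at hdeg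
  have hnum := Polynomial.eq_X_add_C_of_natDegree_le_one
    ((le_max_left _ f.denom.natDegree).trans hdeg.symm.le)
  have hden := Polynomial.eq_X_add_C_of_natDegree_le_one
    ((le_max_right f.num.natDegree _).trans hdeg.symm.le)
  have hden0 : Polynomial.aeval s f.denom ≠ 0 :=
    (transcendental_iff.mp hs _).mt f.denom_ne_zero
  have happ : t = Polynomial.aeval s f.num / Polynomial.aeval s f.denom := by
    rw [← hef]
    exact RatFunc.algEquivOfTranscendental_apply s hs f
  rw [eq_div_iff hden0] at happ
  generalize f.num.coeff 1 = α, f.num.coeff 0 = β at hnum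
  generalize f.denom.coeff 1 = γ, f.denom.coeff 0 = δ at hden
  rw [hnum, hden] at happ
  rw [hden] at hden0
  simp only [map_add, map_mul, Polynomial.aeval_C, Polynomial.aeval_X] at happ hden0
  -- A vanishing determinant gives `γ t = α` and `δ t = β`; as `t` is transcendental, `γ = δ = 0`
  -- and the denominator vanishes.
  refine ⟨α, β, γ, δ, fun hdet => ?_, hden0, happ⟩
  have hdet' : algebraMap K L α * algebraMap K L δ = algebraMap K L β * algebraMap K L γ := by
    rw [← map_mul, ← map_mul, sub_eq_zero.mp hdet]
  have hconst : ∀ x y : K, algebraMap K L x * t = algebraMap K L y → x = 0 := by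
    intro x y hxy
    by_contra hx
    refine htr ?_
    have : t = algebraMap K L (y / x) := by
      rw [map_div₀, eq_div_iff (by simpa using hx), mul_comm, hxy]
    rw [this]
    exact isAlgebraic_algebraMap _
  have h1 : γ = 0 := by
    refine hconst γ α (mul_right_cancel₀ hden0 ?_)
    linear_combination algebraMap K L γ * happ - hdet'
  have h2 : δ = 0 := by
    refine hconst δ β (mul_right_cancel₀ hden0 ?_)
    linear_combination algebraMap K L δ * happ + s * hdet'
  rw [h1, h2] at hden0
  simp at hden0

theorem trdeg_adjoin_simple_of_transcendental {s : L} (hs : Transcendental K s) :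
    Algebra.trdeg K K⟮s⟯ = 1 := by
  have h1 : Algebra.trdeg K (RatFunc K) = 1 := by
    have h2 : Algebra.IsAlgebraic (Polynomial K) (RatFunc K) :=
      IsLocalization.isAlgebraic _ (nonZeroDivisors (Polynomial K))
    rw [← trdeg_add_eq K (Polynomial K) (A := RatFunc K), trdeg_eq_zero (R := Polynomial K),
      add_zero, Polynomial.trdeg_of_isDomain]
  have h3 := (RatFunc.algEquivOfTranscendental s hs).lift_trdeg_eq
  rw [h1, Cardinal.lift_one] at h3
  exact Cardinal.lift_eq_one.mp h3.symm

variable {R : Type*} [CommRing R] [IsDomain R] [Algebra K R] [Algebra R L] [IsScalarTower K R L]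
  [IsFractionRing R L] [UniqueFactorizationMonoid R]

/-- Both `x` and `x⁻¹` are integral over the integrally closed ring `R`, so `x` is a unit of `R`. -/
theorem mem_bot_of_isAlgebraic (hunit : ∀ u : R, IsUnit u → ∃ c : K, u = algebraMap K R c)
    (x : L) (hx : IsAlgebraic K x) : x ∈ (⊥ : IntermediateField K L) := by
  by_cases hx0 : x = 0
  · rw [hx0]
    exact zero_mem _
  obtain ⟨y, hy⟩ := IsIntegrallyClosed.algebraMap_eq_of_integral (R := R)
    (IsIntegral.tower_top hx.isIntegral)
  obtain ⟨z, hz⟩ := IsIntegrallyClosed.algebraMap_eq_of_integral (R := R)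
    (IsIntegral.tower_top hx.inv.isIntegral)
  have hyz : y * z = 1 := by
    apply IsFractionRing.injective R L
    rw [map_mul, hy, hz, map_one, mul_inv_cancel₀ hx0]
  obtain ⟨c, rfl⟩ := hunit y (IsUnit.of_mul_eq_one z hyz)
  rw [← hy, ← IsScalarTower.algebraMap_apply]
  exact IntermediateField.algebraMap_mem _ c

/-- If `σ` acts on `K(s)` with `s = a / b` in lowest terms, then it preserves the span of `a`
and `b`. -/
theorem exists_linear_of_mobius (hunit : ∀ u : R, IsUnit u → ∃ c : K, u = algebraMap K R c)
    {a b a' b' : R} (hb : b ≠ 0) (hb' : b' ≠ 0) (hab : IsRelPrime a b) (hab' : IsRelPrime a' b')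
    {α β γ δ : K} (hdet : α * δ - β * γ ≠ 0)
    (h : a' * (γ • a + δ • b) = b' * (α • a + β • b)) :
    ∃ M : Matrix (Fin 2) (Fin 2) K,
      a' = M 0 0 • a + M 1 0 • b ∧ b' = M 0 1 • a + M 1 1 • b := by
  -- Coprimality yields one factor `u` with `α a + β b = a' u` and `γ a + δ b = b' u`. Inverting the
  -- matrix, `u` divides `a` and `b`, so it is a constant.
  have h1 : b' ∣ γ • a + δ • b :=
    hab'.symm.dvd_of_dvd_mul_left ⟨α • a + β • b, h⟩
  obtain ⟨u, hu⟩ := h1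
  have hu' : α • a + β • b = a' * u := by
    apply mul_left_cancel₀ hb'
    rw [← h, hu]
    ring
  have hD : IsUnit (algebraMap K R (α * δ - β * γ)) := (IsUnit.mk0 _ hdet).map (algebraMap K R)
  simp only [Algebra.smul_def] at hu hu'
  simp only [map_sub, map_mul] at hD
  have hua : u ∣ a := by
    rw [← hD.dvd_mul_left]
    exact ⟨algebraMap K R δ * a' - algebraMap K R β * b', by
      linear_combination algebraMap K R δ * hu' - algebraMap K R β * hu⟩
  have hub : u ∣ b := by
    rw [← hD.dvd_mul_left]
    exact ⟨algebraMap K R α * b' - algebraMap K R γ * a', by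
      linear_combination algebraMap K R α * hu - algebraMap K R γ * hu'⟩
  obtain ⟨c, rfl⟩ := hunit u (hab hua hub)
  have hc : c ≠ 0 := by
    rintro rfl
    rw [map_zero, zero_dvd_iff] at hub
    exact hb hub
  have hcc : algebraMap K R c⁻¹ * algebraMap K R c = 1 := by
    rw [← map_mul, inv_mul_cancel₀ hc, map_one]
  refine ⟨!![c⁻¹ * α, c⁻¹ * γ; c⁻¹ * β, c⁻¹ * δ], ?_, ?_⟩
  · simp [Algebra.smul_def]
    linear_combination -(algebraMap K R c⁻¹) * hu' - a' * hcc
  · simp [Algebra.smul_def]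
    linear_combination -(algebraMap K R c⁻¹) * hu - b' * hcc

theorem hasProjFaithfulRep_of_adjoin_simple {G : Type*} [Group G]
    (hunit : ∀ u : R, IsUnit u → ∃ c : K, u = algebraMap K R c)
    (A : G →* (R ≃ₐ[K] R)) (B : G →* (L ≃ₐ[K] L))
    (hAB : ∀ g x, B g (algebraMap R L x) = algebraMap R L (A g x))
    {s : L} (hs : Transcendental K s) (hstab : ∀ g, B g s ∈ K⟮s⟯) (hfaith : ∀ g, B g s = s → g = 1) :
    HasProjFaithfulRep K G := by
  obtain ⟨a, ⟨b, hb⟩, hab, rfl⟩ := IsFractionRing.exists_reduced_fraction (A := R) s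
  have hb0 : b ≠ 0 := nonZeroDivisors.ne_zero hb
  have hbL : algebraMap R L b ≠ 0 := by simpa using hb0
  rw [IsFractionRing.mk'_eq_div] at hs hstab hfaith
  dsimp only at hab hs hstab hfaith
  set s := algebraMap R L a / algebraMap R L b with hsdef
  have hsb : s * algebraMap R L b = algebraMap R L a := div_mul_cancel₀ _ hbL
  have hadj : ∀ g, K⟮B g s⟯ = K⟮s⟯ := by
    intro g
    refine le_antisymm (adjoin_simple_le_iff.mpr (hstab g)) (adjoin_simple_le_iff.mpr ?_)
    have h1 : (B g : L →ₐ[K] L) (B g⁻¹ s) ∈ K⟮s⟯.map (B g : L →ₐ[K] L) := ⟨_, hstab g⁻¹, rfl⟩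
    rw [adjoin_map, Set.image_singleton] at h1
    have h2 : (B g : L →ₐ[K] L) (B g⁻¹ s) = s := by
      change (B g * B g⁻¹) s = s
      rw [← map_mul, mul_inv_cancel, map_one, AlgEquiv.one_apply]
    rwa [h2] at h1
  have hbg : ∀ g, A g b ≠ 0 := fun g => by simpa using hb0
  have hBg : ∀ g, B g s * algebraMap R L (A g b) = algebraMap R L (A g a) := by
    intro g
    rw [← hAB, ← hAB, ← map_mul, hsb]
  have hex : ∀ g, ∃ M : Matrix (Fin 2) (Fin 2) K,
      A g a = M 0 0 • a + M 1 0 • b ∧ A g b = M 0 1 • a + M 1 1 • b := by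
    intro g
    obtain ⟨α, β, γ, δ, hdet, -, hm⟩ := exists_mobius hs (hadj g)
    refine exists_linear_of_mobius hunit hb0 (hbg g) hab ?_ hdet ?_ (α := α) (β := β) (γ := γ)
      (δ := δ)
    · intro d hd1 hd2
      have h1 := hab (d := (A g).symm d) (by simpa using map_dvd (A g).symm hd1)
        (by simpa using map_dvd (A g).symm hd2)
      simpa using h1
    · apply IsFractionRing.injective R L
      simp only [Algebra.smul_def, map_mul, map_add, ← IsScalarTower.algebraMap_apply]
      rw [← hBg g, ← hsb]
      linear_combination (algebraMap R L b * algebraMap R L (A g b)) * hm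
  choose M hMa hMb using hex
  -- Transcendence of `s = a / b` makes `a` and `b` independent over `K`; thus each `M g` is unique,
  -- and `M` is multiplicative.
  have hli : ∀ x y x' y' : K, x • a + y • b = x' • a + y' • b → x = x' ∧ y = y' := by
    intro x y x' y' h
    have h1 : Polynomial.aeval s
        (Polynomial.C (x - x') * Polynomial.X + Polynomial.C (y - y')) = 0 := by
      simp only [map_add, map_mul, map_sub, Polynomial.aeval_C, Polynomial.aeval_X]
      apply mul_right_cancel₀ hbL
      have h2 := congrArg (algebraMap R L) h
      simp only [Algebra.smul_def, map_mul, map_add, ← IsScalarTower.algebraMap_apply] at h2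
      linear_combination h2 + (algebraMap K L x - algebraMap K L x') * hsb
    have h2 := transcendental_iff.mp hs _ h1
    have h3 := congrArg (fun p => Polynomial.coeff p 1) h2
    have h4 := congrArg (fun p => Polynomial.coeff p 0) h2
    simp [Polynomial.coeff_C] at h3 h4
    exact ⟨sub_eq_zero.mp h3, sub_eq_zero.mp h4⟩
  have huniq : ∀ (g : G) (N : Matrix (Fin 2) (Fin 2) K), A g a = N 0 0 • a + N 1 0 • b →
      A g b = N 0 1 • a + N 1 1 • b → M g = N := by
    intro g N h1 h2
    obtain ⟨h3, h4⟩ := hli _ _ _ _ ((hMa g).symm.trans h1)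
    obtain ⟨h5, h6⟩ := hli _ _ _ _ ((hMb g).symm.trans h2)
    ext i j
    fin_cases i <;> fin_cases j <;> assumption
  refine ⟨⟨⟨M, huniq 1 1 (by simp) (by simp)⟩, fun g h => huniq _ _ ?_ ?_⟩, ?_⟩
  · rw [map_mul, AlgEquiv.mul_apply, hMa h, map_add, map_smul, map_smul, hMa g, hMb g]
    simp only [Matrix.mul_apply, Fin.sum_univ_two, Algebra.smul_def, map_add, map_mul]
    ring
  · rw [map_mul, AlgEquiv.mul_apply, hMb h, map_add, map_smul, map_smul, hMa g, hMb g]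
    simp only [Matrix.mul_apply, Fin.sum_univ_two, Algebra.smul_def, map_add, map_mul]
    ring
  · intro g c hc
    change M g = c • 1 at hc
    refine hfaith g ?_
    have h1 := hMa g
    have h2 := hMb g
    simp [hc] at h1 h2
    have h3 := hBg g
    rw [h1, h2, Algebra.smul_def, Algebra.smul_def, map_mul, map_mul, ← hsb] at h3
    have h4 : algebraMap R L (algebraMap K R c) * algebraMap R L b ≠ 0 := by
      rw [← map_mul, ← Algebra.smul_def, ← h2]
      simpa using hb0
    refine mul_right_cancel₀ h4 ?_
    linear_combination h3

end Mobius

/-! ### Planes inside the function field -/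

section TwoDimensional

open IntermediateField

variable {K L : Type*} [Field K] [Field L] [Algebra K L]

/-- A nonscalar `2 × 2` matrix has a cyclic row vector. -/
theorem exists_cyclic_row {M : Matrix (Fin 2) (Fin 2) K} (hM : ∀ c : K, M ≠ c • 1) :
    ∃ l : Fin 2 → K, ∀ v : Fin 2 → K, l ⬝ᵥ v = 0 → l ⬝ᵥ M.mulVec v = 0 → v = 0 := by
  -- The expression is the determinant of the rows `l` and `l M`, a quadratic form in `l`; vanishing
  -- at `(1,0)`, `(0,1)` and `(1,1)` makes `M` scalar.
  have key : ∀ l : Fin 2 → K,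
      l 0 * (l 0 * M 0 1 + l 1 * M 1 1) - l 1 * (l 0 * M 0 0 + l 1 * M 1 0) ≠ 0 →
      ∀ v : Fin 2 → K, l ⬝ᵥ v = 0 → l ⬝ᵥ M.mulVec v = 0 → v = 0 := by
    intro l hl v h1 h2
    simp only [dotProduct, Matrix.mulVec, Fin.sum_univ_two] at h1 h2
    have e0 : v 0 = 0 := by
      refine (mul_eq_zero.mp ?_).resolve_left hl
      linear_combination (l 0 * M 0 1 + l 1 * M 1 1) * h1 - l 1 * h2
    have e1 : v 1 = 0 := by
      refine (mul_eq_zero.mp ?_).resolve_left hl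
      linear_combination l 0 * h2 - (l 0 * M 0 0 + l 1 * M 1 0) * h1
    ext i
    fin_cases i
    · exact e0
    · exact e1
  by_contra! h
  have h1 : ∀ l : Fin 2 → K,
      l 0 * (l 0 * M 0 1 + l 1 * M 1 1) - l 1 * (l 0 * M 0 0 + l 1 * M 1 0) = 0 := by
    intro l
    by_contra hl
    obtain ⟨v, hv1, hv2, hv⟩ := h l
    exact hv (key l hl v hv1 hv2)
  have h01 := h1 ![1, 0]
  have h10 := h1 ![0, 1]
  have h11 := h1 ![1, 1]
  simp at h01 h10 h11
  refine hM (M 0 0) ?_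
  rw [h01, h10] at h11
  ext i j
  fin_cases i <;> fin_cases j <;> simp [h01, h10]
  linear_combination h11

variable {H : Subgroup (L ≃ₐ[K] L)}

/-- By the normal basis theorem over the fixed field, `L` contains the regular representation of `H`
over `K`. -/
theorem exists_linearIndependent_orbit [Finite H] :
    ∃ w : L, LinearIndependent K fun σ : H => σ.1 w := by
  have hfd : FiniteDimensional (fixedField H) L := IsGaloisGroup.finiteDimensional H _ _
  obtain ⟨w, hw⟩ := exists_linearIndependent_algEquiv_apply (fixedField H) L
  refine ⟨w, ?_⟩
  have h1 := hw.comp (IsGaloisGroup.mulEquivAlgEquiv H (fixedField H) L)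
    (MulEquiv.injective _)
  exact h1.restrict_scalars' K

/-- A representation by `2 × 2` matrices, not all scalar, embeds equivariantly into `L`. -/
theorem exists_equivariant_embedding [Finite H] (ψ : H →* Matrix (Fin 2) (Fin 2) K) {h₀ : H}
    (h0 : ∀ c : K, ψ h₀ ≠ c • 1) :
    ∃ F : (Fin 2 → K) →ₗ[K] L, Function.Injective F ∧
      ∀ (σ : H) (v : Fin 2 → K), σ.1 (F v) = F ((ψ σ).mulVec v) := by
  have := Fintype.ofFinite H
  obtain ⟨w, hw⟩ := exists_linearIndependent_orbit (H := H)
  obtain ⟨l, hl⟩ := exists_cyclic_row h0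
  -- The functional `l` induces an equivariant map into the regular representation; its coefficients
  -- at `1` and `h₀⁻¹` already determine `v`.
  let F : (Fin 2 → K) →ₗ[K] L :=
    { toFun := fun v => ∑ σ : H, (l ⬝ᵥ (ψ σ⁻¹).mulVec v) • σ.1 w
      map_add' := fun v v' => by
        simp only [Matrix.mulVec_add, dotProduct_add, add_smul, Finset.sum_add_distrib]
      map_smul' := fun c v => by
        simp only [Matrix.mulVec_smul, dotProduct_smul, Finset.smul_sum, smul_smul, smul_eq_mul,
          RingHom.id_apply] }
  refine ⟨F, ?_, fun τ v => ?_⟩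
  · rw [← LinearMap.ker_eq_bot, LinearMap.ker_eq_bot']
    intro v hv
    have h1 := Fintype.linearIndependent_iff.mp hw _ hv
    refine hl v ?_ ?_
    · simpa using h1 1
    · simpa using h1 h₀⁻¹
  · change τ.1 (∑ σ : H, (l ⬝ᵥ (ψ σ⁻¹).mulVec v) • σ.1 w) =
      ∑ σ : H, (l ⬝ᵥ (ψ σ⁻¹).mulVec ((ψ τ).mulVec v)) • σ.1 w
    rw [map_sum]
    refine Fintype.sum_equiv (Equiv.mulLeft τ) _ _ fun σ => ?_
    rw [map_smul, Equiv.coe_mulLeft, Matrix.mulVec_mulVec, ← map_mul, mul_inv_rev,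
      inv_mul_cancel_right]
    rfl

/-- The field is `K(a / b)` for a basis `a`, `b` of an equivariant plane in `L`. The quotient is not
in `K`, hence transcendental, and only elements acting by scalars fix it. -/
theorem exists_isFaithfulStable_of_hasProjFaithfulRep [Finite H] [Nontrivial H]
    (hK : ∀ x : L, IsAlgebraic K x → x ∈ (⊥ : IntermediateField K L))
    (h : HasProjFaithfulRep K H) :
    ∃ E : IntermediateField K L, IsFaithfulStable H E ∧ Algebra.trdeg K E = 1 := by
  obtain ⟨ψ, hψ⟩ := h
  obtain ⟨h₀, hh₀⟩ := exists_ne (1 : H)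
  obtain ⟨F, hF, hFψ⟩ := exists_equivariant_embedding ψ fun c hc => hh₀ (hψ h₀ c hc)
  set a := F ![1, 0] with ha
  set b := F ![0, 1] with hb
  have hb0 : b ≠ 0 := by
    rw [hb, map_ne_zero_iff F hF]
    intro h
    simpa using congrFun h 1
  set s := a / b with hs
  have hsb : s * b = a := div_mul_cancel₀ a hb0
  have htr : Transcendental K s := by
    intro halg
    obtain ⟨c, hc⟩ := mem_bot.mp (hK s halg)
    have h1 : F ![1, -c] = 0 := by
      have : (![1, -c] : Fin 2 → K) = ![1, 0] - c • ![0, 1] := by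
        ext i; fin_cases i <;> simp
      rw [this, map_sub, map_smul, ← ha, ← hb, ← hsb, ← hc, Algebra.smul_def, sub_self]
    have h2 := (map_eq_zero_iff F hF).mp h1
    simpa using congrFun h2 0
  have hact : ∀ (σ : H) (v : Fin 2 → K), F ((ψ σ).mulVec v) =
      algebraMap K L ((ψ σ).mulVec v 0) * a + algebraMap K L ((ψ σ).mulVec v 1) * b := by
    intro σ v
    rw [ha, hb, ← Algebra.smul_def, ← Algebra.smul_def, ← map_smul, ← map_smul, ← map_add]
    congr 1
    ext i
    fin_cases i <;> simp
  have hσa : ∀ σ : H, σ.1 a = (algebraMap K L (ψ σ 0 0) * s + algebraMap K L (ψ σ 1 0)) * b := by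
    intro σ
    rw [ha, hFψ, hact, ← hsb]
    simp [Matrix.mulVec, dotProduct, Fin.sum_univ_two]
    ring
  have hσb : ∀ σ : H, σ.1 b = (algebraMap K L (ψ σ 0 1) * s + algebraMap K L (ψ σ 1 1)) * b := by
    intro σ
    rw [hb, hFψ, hact, ← hsb]
    simp [Matrix.mulVec, dotProduct, Fin.sum_univ_two]
    ring
  have hσb0 : ∀ σ : H, σ.1 b ≠ 0 := fun σ => by simpa using hb0
  have hσs : ∀ σ : H, σ.1 s = (algebraMap K L (ψ σ 0 0) * s + algebraMap K L (ψ σ 1 0)) /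
      (algebraMap K L (ψ σ 0 1) * s + algebraMap K L (ψ σ 1 1)) := by
    intro σ
    rw [hs, map_div₀, hσa, hσb, mul_div_mul_right _ _ hb0]
  have hsmem : s ∈ K⟮s⟯ := mem_adjoin_simple_self K s
  refine ⟨K⟮s⟯, ⟨fun σ hσ x hx => ?_, fun σ hσ hx => ?_⟩, trdeg_adjoin_simple_of_transcendental htr⟩
  · have h1 : (σ : L →ₐ[K] L) x ∈ K⟮s⟯.map (σ : L →ₐ[K] L) := ⟨x, hx, rfl⟩
    rw [adjoin_map, Set.image_singleton] at h1
    refine (adjoin_simple_le_iff.mpr ?_ : K⟮(σ : L →ₐ[K] L) s⟯ ≤ K⟮s⟯) h1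
    change (⟨σ, hσ⟩ : H).1 s ∈ K⟮s⟯
    rw [hσs]
    exact div_mem (add_mem (mul_mem (IntermediateField.algebraMap_mem _ _) hsmem)
      (IntermediateField.algebraMap_mem _ _)) (add_mem (mul_mem
      (IntermediateField.algebraMap_mem _ _) hsmem) (IntermediateField.algebraMap_mem _ _))
  · have h1 : (⟨σ, hσ⟩ : H).1 s = s := hx s hsmem
    set τ : H := ⟨σ, hσ⟩ with hτ
    have h2 : algebraMap K L (ψ τ 0 1) * s + algebraMap K L (ψ τ 1 1) ≠ 0 := by
      intro h0
      apply hσb0 τ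
      rw [hσb, h0, zero_mul]
    rw [hσs, div_eq_iff h2] at h1
    have h3 : Polynomial.aeval s (Polynomial.C (ψ τ 0 1) * Polynomial.X ^ 2 +
        Polynomial.C (ψ τ 1 1 - ψ τ 0 0) * Polynomial.X + Polynomial.C (-ψ τ 1 0)) = 0 := by
      simp only [map_add, map_mul, map_pow, Polynomial.aeval_C, Polynomial.aeval_X, map_sub,
        map_neg]
      linear_combination -h1
    have h4 := transcendental_iff.mp htr _ h3
    have e0 := congrArg (fun p => Polynomial.coeff p 0) h4
    have e1 := congrArg (fun p => Polynomial.coeff p 1) h4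
    have e2 := congrArg (fun p => Polynomial.coeff p 2) h4
    simp [Polynomial.coeff_X, Polynomial.coeff_C, Polynomial.coeff_X_pow] at e0 e1 e2
    have h5 : ψ τ = ψ τ 0 0 • 1 := by
      ext i j
      fin_cases i <;> fin_cases j <;> simp [e0, e2]
      linear_combination e1
    exact congrArg Subtype.val (hψ τ _ h5)

end TwoDimensional

theorem symmetricAlgebra_ι_injective {K M : Type*} [Field K] [AddCommGroup M] [Module K M] :
    Function.Injective (SymmetricAlgebra.ι K M) := by
  rw [← LinearMap.ker_eq_bot, LinearMap.ker_eq_bot']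
  intro m hm
  rw [← Module.forall_dual_apply_eq_zero_iff K]
  intro φ
  have h := SymmetricAlgebra.lift_ι_apply
    (LinearMap.toSpanSingleton K (Polynomial K) Polynomial.X ∘ₗ φ) m
  rw [hm, map_zero] at h
  simpa using h.symm

/-! ### The criterion for function fields of representations -/

section FunctionFields

open IntermediateField

variable {K V G : Type*} [Field K] [AddCommGroup V] [Module K V] [Module.Finite K V]

instance coordRing_uniqueFactorizationMonoid :
    UniqueFactorizationMonoid (EssDim.CoordRing K V) :=
  (SymmetricAlgebra.equivMvPolynomial
    (Module.finBasis K (Module.Dual K V))).symm.toMulEquiv.uniqueFactorizationMonoid inferInstance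

theorem coordRing_isUnit (u : EssDim.CoordRing K V) (hu : IsUnit u) :
    ∃ c : K, u = algebraMap K _ c := by
  let e := SymmetricAlgebra.equivMvPolynomial (Module.finBasis K (Module.Dual K V))
  obtain ⟨c, -, hc⟩ := MvPolynomial.isUnit_iff_eq_C_of_isReduced.mp (hu.map e)
  refine ⟨c, e.injective ?_⟩
  rw [hc, AlgEquiv.commutes]
  rfl

theorem coordRing_exists_algHom (a b : EssDim.CoordRing K V) (hb : b ≠ 0)
    (hab : ∀ c : K, a ≠ c • b) : ∃ θ : EssDim.CoordRing K V →ₐ[K] Polynomial K,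
      θ b ≠ 0 ∧ ∀ c : K, θ a ≠ c • θ b := by
  let e := SymmetricAlgebra.equivMvPolynomial (Module.finBasis K (Module.Dual K V))
  obtain ⟨θ, h1, h2⟩ := exists_algHom_polynomial (e a) (e b) (by simpa using hb) (fun c hc => by
    rw [← map_smul] at hc
    exact hab c (e.injective hc))
  exact ⟨θ.comp e.toAlgHom, h1, h2⟩

variable [Group G]

theorem funAction_algebraMap (ρ : Representation K G V) (g : G) (x : EssDim.CoordRing K V) :
    EssDim.funAction ρ g (algebraMap _ (EssDim.FunField K V) x) =
      algebraMap _ _ (EssDim.coordAction ρ g x) :=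
  IsFractionRing.fieldEquivOfAlgEquiv_algebraMap _ _ _ _ _

theorem funAction_injective {ρ : Representation K G V} (hρ : Function.Injective ρ) :
    Function.Injective (EssDim.funAction ρ) := by
  refine (IsFractionRing.fieldEquivOfAlgEquivHom_injective K _ K _).comp ?_
  rw [injective_iff_map_eq_one]
  intro g hg
  have h1 : ∀ f : Module.Dual K V, ρ.dual g f = f := by
    intro f
    apply symmetricAlgebra_ι_injective (K := K)
    rw [← EssDim.coordHom_ι]
    exact DFunLike.congr_fun hg (SymmetricAlgebra.ι K _ f)
  -- The dual action precomposes with `ρ g⁻¹`, and linear forms separate vectors.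
  have h2 : ρ g⁻¹ = 1 := by
    ext v
    rw [← sub_eq_zero, ← Module.forall_dual_apply_eq_zero_iff K]
    intro f
    rw [map_sub, sub_eq_zero]
    exact DFunLike.congr_fun (h1 f) v
  exact inv_eq_one.mp (hρ (h2.trans (map_one ρ).symm))

theorem HasProjFaithfulRep.of_mulEquiv {G G' : Type*} [Group G] [Group G'] (e : G ≃* G')
    (h : HasProjFaithfulRep K G) : HasProjFaithfulRep K G' := by
  obtain ⟨ψ, hψ⟩ := h
  exact ⟨ψ.comp e.symm.toMonoidHom, fun g c hc =>
    (MulEquiv.map_eq_one_iff e.symm).mp (hψ (e.symm g) c hc)⟩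

/-- A finite nontrivial group has essential dimension one over `K` if and only if it has a
two-dimensional representation over `K` in which only the identity acts by a scalar. -/
theorem essDim_eq_one_iff [Finite G] [Nontrivial G] {ρ : Representation K G V}
    (hρ : Function.Injective ρ) : EssDim.essDim ρ = 1 ↔ HasProjFaithfulRep K G := by
  let e : G ≃* (EssDim.funAction ρ).range := MonoidHom.ofInjective (funAction_injective hρ)
  have : Finite (EssDim.funAction ρ).range := Finite.of_equiv _ e.toEquiv
  have : Nontrivial (EssDim.funAction ρ).range := e.symm.toEquiv.nontrivial
  have hK := mem_bot_of_isAlgebraic (L := EssDim.FunField K V) (coordRing_isUnit (K := K) (V := V))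
  rw [EssDim.essDim, EssDim.invField, extEssDim_fixedField_eq_one_iff hK]
  constructor
  · rintro ⟨E, hE, hd⟩
    obtain ⟨j⟩ := nonempty_algHom_ratFunc (R := EssDim.CoordRing K V) coordRing_exists_algHom E hd
    obtain ⟨s, hs, rfl⟩ := exists_eq_adjoin_simple_of_algHom hd j
    have hsmem : s ∈ K⟮s⟯ := mem_adjoin_simple_self K s
    refine hasProjFaithfulRep_of_adjoin_simple coordRing_isUnit (EssDim.coordAction ρ)
      (EssDim.funAction ρ) (funAction_algebraMap ρ) hs (fun g => hE.1 _ ⟨g, rfl⟩ s hsmem)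
      fun g hg => funAction_injective hρ ?_
    rw [map_one]
    refine hE.2 _ ⟨g, rfl⟩ fun x hx => ?_
    obtain ⟨p, q, rfl⟩ := (mem_adjoin_simple_iff K x).mp hx
    rw [map_div₀, ← Polynomial.aeval_algHom_apply, ← Polynomial.aeval_algHom_apply, hg]
  · exact fun h => exists_isFaithfulStable_of_hasProjFaithfulRep hK (h.of_mulEquiv e)

end FunctionFields

theorem theorem5p8 {K V : Type*} [Field K] [AddCommGroup V] [Module K V] [Module.Finite K V]
    (n : ℕ) (hn : 1 ≤ n)
    (ρ : Representation K (DihedralGroup n) V) (hρ : Function.Injective ρ) :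
    (ringChar K ≠ 2 →
      (EssDim.essDim ρ = 1 ↔
        Odd n ∧ (¬ ringChar K ∣ n → EssDim.ZetaAddInvMem K n) ∧
          (ringChar K ∣ n → n = ringChar K))) ∧
    (ringChar K = 2 →
      (EssDim.essDim ρ = 1 ↔
        (Odd n → EssDim.ZetaAddInvMem K n) ∧ (Even n → 4 ≤ Cardinal.mk K ∧ n = 2))) := by
  -- This makes the group finite, as `DihedralGroup 0` is infinite; for `n = 1` it has order two, so
  -- it is never trivial.
  have : NeZero n := ⟨by omega⟩
  rw [essDim_eq_one_iff hρ]
  exact hasProjFaithfulRep_dihedral_iff hn
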